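/- **The CCV $\lambda\mu$-calculus.** Terms $M$ and jumps $J$ are given by $$M ::= x \mid \lambda x.\,M \mid MM \mid M\lceil x:=M\rfloor \mid \mu k.\,J,\qquad J ::= [k]M \mid J\lceil x:=M\rfloor ,$$ where $x$ ranges over ordinary variables, $k$ over continuation variables, and $L\lceil x:=M\rfloor$ stands for $\mathsf{let}\ x=M\ \mathsf{in}\ L$. Expressions are taken up to renaming of bound variables and up to the congruence generated by $$L\lceil x:=M\lceil y:=N\rfloor\rfloor=(L\lceil x:=M\rfloor)\lceil y:=N\rfloor\ \ (y\notin L),\qquad [k](L\lceil x:=M\rfloor)=([k]L)\lceil x:=M\rfloor .$$ A value is a variable or a $\lambda$-abstraction. With $V$ a value, $N$ a non-value and $z$ fresh, reduction is the closure under all contexts of the rules - $NM\to (zM)\lceil z:=N\rfloor$; $\quad VN\to (Vz)\lceil z:=N\rfloor$; - $(\lambda x.M)V\to M\lceil x:=V\rfloor$; $\quad M\lceil x:=V\rfloor\to M\{V/x\}$; - $M\lceil x:=\mu k.J\rfloor\to \mu k.\,J\{[k]\square\mapsto [k]M\lceil x:=\square\rfloor\}$ ($k\notin M$); $\quad [l]\mu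 k.J\to J\{l/k\}$; - $\lambda x.Vx\to V$ ($x\notin V$); $\quad x\lceil x:=M\rfloor\to M$; $\quad \mu k.[k]M\to M$ ($k\notin M$); - $(\mu k.J)\lceil x:=M\rfloor\to\mu k.(J\lceil x:=M\rfloor)$ ($k\notin M$). Types are $R::=\alpha\mid S\to T$, $S::=\bigcap_i R_i$, $T::=\bigcup_i S_i$, where $\alpha$ ranges over atomic types and intersections and unions are finite and nonempty. The relation $\le$ is generated by $\alpha\le\alpha$; by $S\to T\le S'\to T'$ if $S'\le S$ and $T\le T'$; by $S\cap S''\le S'$ if $S\le S'$; by $S\le\bigcap_i S_i$ if $S\le S_i$ for all $i$; by $T\le T''\cup T'$ if $T\le T'$; and by $\bigcup_i T_i\le T$ if $T_i\le T$ for all $i$. Judgements $\Gamma\vdash M:T\mid\Delta$ and $\Gamma\vdash J:\bot\!\!\!\bot\mid\Delta$, with $\Gamma$ a finite sequence of $x:S$ and $\Delta$ a finite sequence of $k:T$, are derived by the rules (all index sets are finite and nonempty) - $\Gamma,x:S\vdash x:S\mid\Delta$; - if $\Gamma,x:S_i\vdash M:T_i\mid\Delta$ for all $i$, then $\Gamma\vdash\lambda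 x.M:\bigcap_i(S_i\to T_i)\mid\Delta$; - if $\Gamma\vdash M:\bigcup_i\bigcap_j(S_{ij}\to T)\mid\Delta$ and $\Gamma\vdash N:\bigcup_jS_{ij}\mid\Delta$ for all $i$, then $\Gamma\vdash MN:T\mid\Delta$; - if $\Gamma,x:S_i\vdash L:\rho\mid\Delta$ for all $i$ and $\Gamma\vdash N:\bigcup_iS_i\mid\Delta$, then $\Gamma\vdash L\lceil x:=N\rfloor:\rho\mid\Delta$ (for $L$ a term and $\rho$ a type $T$, or $L$ a jump and $\rho=\bot\!\!\!\bot$); - if $\Gamma\vdash J:\bot\!\!\!\bot\mid\Delta,k:T$, then $\Gamma\vdash\mu k.J:T\mid\Delta$; - if $\Gamma\vdash M:T\mid\Delta,k:T$, then $\Gamma\vdash[k]M:\bot\!\!\!\bot\mid\Delta,k:T$; - if $\Gamma\vdash M:T\mid\Delta$ and $T\le T'$, then $\Gamma\vdash M:T'\mid\Delta$. A term $M$ is typeable if $\Gamma\vdash M:T\mid\Delta$ is derivable for some $\Gamma,\Delta,T$. A term is strongly normalizing if all reduction sequences starting from it are finite. **The dot calculus.** Terms are the $\lambda$-terms extended by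 a binary operator $M\cdot N$, taken up to associativity $(L\cdot M)\cdot N=L\cdot(M\cdot N)$ of the dot; reduction is $\beta\eta$-reduction together with $M\cdot N\to N$, in all contexts. Types are $\sigma::=\bot\!\!\!\bot\mid\alpha\mid\tau\to\sigma$ and $\tau::=\bigcap_i\sigma_i$ (finite nonempty intersections, so no $\omega$), with the usual subtyping (contravariant on the left of arrows, covariant on the right, $\bigcap_i\sigma_i\le\bigcap_j\sigma'_j$ if each $\sigma'_j$ is above some $\sigma_i$). Judgements $\Gamma\vdash_sM:\sigma$, with $\Gamma$ a finite sequence of $x:\tau$, are derived by the standard rules of intersection types: $\Gamma,x:\bigcap_i\sigma_i\vdash_sx:\sigma_i$; from $\Gamma,x:\tau\vdash_sM:\sigma$ infer $\Gamma\vdash_s\lambda x.M:\tau\to\sigma$; from $\Gamma\vdash_sM:(\bigcap_i\sigma_i)\to\sigma$ and $\Gamma\vdash_sN:\sigma_i$ for all $i$ infer $\Gamma\vdash_sMN:\sigma$; from $\Gamma\vdash_sM:\sigma$ and $\sigma\le\sigma'$ infer $\Gamma\vdash_sM:\sigma'$; and from $\Gamma\vdash_sM:\bot\!\!\!\bot$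 and $\Gamma\vdash_sN:\bot\!\!\!\bot$ infer $\Gamma\vdash_sM\cdot N:\bot\!\!\!\bot$. **Proposition.** 1. Every typeable CCV $\lambda\mu$-term is strongly normalizing. 2. If $\Gamma\vdash_sM:\sigma$ is derivable in the dot calculus, then $M$ is strongly normalizing. -/

import Mathlib

universe u

/-! ## The CCV lambda-mu calculus

Expressions are taken up to renaming of bound variables: ordinary variables and continuation
variables are two independent families of de Bruijn indices. `lam` and the body of `lett` bind
the ordinary index `0`; `mu` binds the continuation index `0`. -/

namespace CCV

/-- The two syntactic categories: terms `M` and jumps `J`. -/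
inductive Srt : Type
  | term
  | jump

/-- Raw expressions.
`lett L M` is the let-expression with body `L` (a term or a jump, in which the ordinary
variable `0` is bound) and argument `M`; `mu J` is `μk. J`; `jmp k M` is `[k]M`. -/
inductive Exp : Srt → Type
  | var : ℕ → Exp Srt.term
  | lam : Exp Srt.term → Exp Srt.term
  | app : Exp Srt.term → Exp Srt.term → Exp Srt.term
  | lett : {s : Srt} → Exp s → Exp Srt.term → Exp s
  | mu : Exp Srt.jump → Exp Srt.term
  | jmp : ℕ → Exp Srt.term → Exp Srt.jump

/-- CCV lambda-mu terms. -/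
abbrev Term : Type := Exp Srt.term

/-- CCV lambda-mu jumps. -/
abbrev Jump : Type := Exp Srt.jump

/-- A renaming pushed under one binder. -/
def up (ρ : ℕ → ℕ) : ℕ → ℕ
  | 0 => 0
  | n + 1 => ρ n + 1

namespace Exp

/-- Simultaneous renaming: `ρ` acts on ordinary variables, `θ` on continuation variables. -/
def ren : (ρ θ : ℕ → ℕ) → {s : Srt} → Exp s → Exp s
  | ρ, _, _, var n => var (ρ n)
  | ρ, θ, _, lam M => lam (ren (up ρ) θ M)
  | ρ, θ, _, app M N => app (ren ρ θ M) (ren ρ θ N)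
  | ρ, θ, _, lett L M => lett (ren (up ρ) θ L) (ren ρ θ M)
  | ρ, θ, _, mu J => mu (ren ρ (up θ) J)
  | ρ, θ, _, jmp k M => jmp (θ k) (ren ρ θ M)

/-- Weakening by a fresh ordinary variable, which gets index `0`. -/
def shift {s : Srt} (M : Exp s) : Exp s := ren Nat.succ id M

/-- Weakening by a fresh continuation variable, which gets index `0`. -/
def cshift {s : Srt} (M : Exp s) : Exp s := ren id Nat.succ M

/-- A substitution pushed under a binder of an ordinary variable. -/
def upSubst (σ : ℕ → Term) : ℕ → Term
  | 0 => var 0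
  | n + 1 => shift (σ n)

/-- Simultaneous capture-avoiding substitution for the ordinary variables. -/
def subst : (σ : ℕ → Term) → {s : Srt} → Exp s → Exp s
  | σ, _, var n => σ n
  | σ, _, lam M => lam (subst (upSubst σ) M)
  | σ, _, app M N => app (subst σ M) (subst σ N)
  | σ, _, lett L M => lett (subst (upSubst σ) L) (subst σ M)
  | σ, _, mu J => mu (subst (fun n => cshift (σ n)) J)
  | σ, _, jmp k M => jmp k (subst σ M)

/-- The substitution of `V` for the ordinary variable `0`; the other indices go down by one. -/
def single (V : Term) : ℕ → Term
  | 0 => V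
  | n + 1 => var n

/-- `M{V/x}`, where `x` is the ordinary variable `0` of `M`. -/
def inst {s : Srt} (M : Exp s) (V : Term) : Exp s := subst (single V) M

/-- The renaming of the continuation variable `0` to `l`; the other indices go down by one. -/
def csingle (l : ℕ) : ℕ → ℕ
  | 0 => l
  | n + 1 => n

/-- `J{l/k}`, where `k` is the continuation variable `0` of `J`. -/
def cinst {s : Srt} (J : Exp s) (l : ℕ) : Exp s := ren id (csingle l) J

/-- The context substitution `{[k]□ ↦ [k](let x = □ in M)}`: every jumper `[k]N` is replaced by
`[k](let x = N' in M)`, with `N'` the result of the same substitution in `N`. Here `x` is the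
ordinary variable `0` of `M`. -/
def csubst : (k : ℕ) → (M : Term) → {s : Srt} → Exp s → Exp s
  | _, _, _, var n => var n
  | k, M, _, lam N => lam (csubst k (ren (up Nat.succ) id M) N)
  | k, M, _, app N P => app (csubst k M N) (csubst k M P)
  | k, M, _, lett L N => lett (csubst k (ren (up Nat.succ) id M) L) (csubst k M N)
  | k, M, _, mu J => mu (csubst (k + 1) (cshift M) J)
  | k, M, _, jmp j N => if j = k then jmp j (lett M (csubst k M N)) else jmp j (csubst k M N)

end Exp

open Exp

/-- Values: variables and lambda abstractions. -/
inductive IsValue : Term → Prop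
  | var (n : ℕ) : IsValue (var n)
  | lam (M : Term) : IsValue (lam M)

/-- Closure of a relation on expressions under all contexts. -/
inductive Compat (R : ∀ s : Srt, Exp s → Exp s → Prop) : ∀ s : Srt, Exp s → Exp s → Prop
  | root {s : Srt} {M N : Exp s} : R s M N → Compat R s M N
  | lam {M M' : Term} : Compat R Srt.term M M' → Compat R Srt.term (lam M) (lam M')
  | appL {M M' N : Term} :
      Compat R Srt.term M M' → Compat R Srt.term (app M N) (app M' N)
  | appR {M N N' : Term} :
      Compat R Srt.term N N' → Compat R Srt.term (app M N) (app M N')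
  | lettL {s : Srt} {L L' : Exp s} {M : Term} :
      Compat R s L L' → Compat R s (lett L M) (lett L' M)
  | lettR {s : Srt} {L : Exp s} {M M' : Term} :
      Compat R Srt.term M M' → Compat R s (lett L M) (lett L M')
  | mu {J J' : Jump} : Compat R Srt.jump J J' → Compat R Srt.term (mu J) (mu J')
  | jmp {k : ℕ} {M M' : Term} :
      Compat R Srt.term M M' → Compat R Srt.jump (jmp k M) (jmp k M')

/-- The two associativity axioms. In the first one, `L` does not contain the variable bound
by the outer let of the right-hand side, hence the renaming, which keeps `0` and skips `1`. -/
inductive AssocAx : ∀ s : Srt, Exp s → Exp s → Prop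
  | lett (L M N : Term) :
      AssocAx Srt.term (lett L (lett M N)) (lett (lett (ren (up Nat.succ) id L) M) N)
  | jmp (k : ℕ) (L M : Term) :
      AssocAx Srt.jump (jmp k (lett L M)) (lett (jmp k L) M)

/-- The syntactic equality of the calculus: the congruence generated by the two associativity
axioms. Terms (and jumps) related by it are the same term (jump). -/
def Same (s : Srt) : Exp s → Exp s → Prop := Relation.EqvGen (Compat AssocAx s)

/-- The ten reduction rules. -/
inductive Rule : ∀ s : Srt, Exp s → Exp s → Prop
  | ad1 (N M : Term) : ¬ IsValue N →
      Rule Srt.term (app N M) (lett (app (var 0) (shift M)) N)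
  | ad2 (V N : Term) : IsValue V → ¬ IsValue N →
      Rule Srt.term (app V N) (lett (app (shift V) (var 0)) N)
  | betaLam (M V : Term) : IsValue V → Rule Srt.term (app (lam M) V) (lett M V)
  | betaLet (M V : Term) : IsValue V → Rule Srt.term (lett M V) (inst M V)
  | betaMu (M : Term) (J : Jump) :
      Rule Srt.term (lett M (mu J)) (mu (csubst 0 (cshift M) J))
  | betaJmp (l : ℕ) (J : Jump) : Rule Srt.jump (jmp l (mu J)) (cinst J l)
  | etaLam (V : Term) : IsValue V → Rule Srt.term (lam (app (shift V) (var 0))) V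
  | etaLet (M : Term) : Rule Srt.term (lett (var 0) M) M
  | etaMu (M : Term) : Rule Srt.term (mu (jmp 0 (cshift M))) M
  | exch (J : Jump) (M : Term) :
      Rule Srt.term (lett (mu J) M) (mu (lett J (cshift M)))

/-- One-step reduction of terms and jumps taken up to syntactic equality: a rule may be applied
anywhere in any expression that is syntactically equal to the given one. -/
def Step (s : Srt) (M N : Exp s) : Prop :=
  ∃ M' N' : Exp s, Same s M M' ∧ Compat Rule s M' N' ∧ Same s N' N

/-- Strong normalizability: every reduction sequence from `M` is finite. -/
def StronglyNormalizable (M : Term) : Prop :=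
  Acc (fun N P : Term => Step Srt.term P N) M

/-! ### Union-intersection types

`A` is the collection of atomic types. A formal intersection or union is a nonempty finite
family; so associativity is built in, while commutativity is respected by subtyping. -/

mutual

/-- Raw types `R ::= α | S → T`. -/
inductive RawTy (A : Type u) : Type u
  | atom : A → RawTy A
  | arr : SubTy A → UTy A → RawTy A

/-- Subsidiary types `S ::= R₀ ∩ ⋯ ∩ Rₙ`. -/
inductive SubTy (A : Type u) : Type u
  | inter : (n : ℕ) → (Fin (n + 1) → RawTy A) → SubTy A

/-- Types `T ::= S₀ ∪ ⋯ ∪ Sₙ`. -/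
inductive UTy (A : Type u) : Type u
  | union : (n : ℕ) → (Fin (n + 1) → SubTy A) → UTy A

end

/-- A subsidiary type regarded as a type. -/
def UTy.ofSub {A : Type u} (S : SubTy A) : UTy A := UTy.union 0 (fun _ => S)

mutual

/-- Subtyping between raw types. -/
inductive RawLe {A : Type u} : RawTy A → RawTy A → Prop
  | atom (a : A) : RawLe (RawTy.atom a) (RawTy.atom a)
  | arr {S S' : SubTy A} {T T' : UTy A} :
      SubLe S' S → ULe T T' → RawLe (RawTy.arr S T) (RawTy.arr S' T')

/-- Subtyping between subsidiary types: each component on the right is above some component on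
the left (projection followed by introduction of the intersection). -/
inductive SubLe {A : Type u} : SubTy A → SubTy A → Prop
  | inter {m n : ℕ} {R : Fin (m + 1) → RawTy A} {R' : Fin (n + 1) → RawTy A}
      (f : Fin (n + 1) → Fin (m + 1)) :
      (∀ j, RawLe (R (f j)) (R' j)) → SubLe (SubTy.inter m R) (SubTy.inter n R')

/-- Subtyping between types: each component on the left is below some component on the right
(injection followed by elimination of the union). -/
inductive ULe {A : Type u} : UTy A → UTy A → Prop
  | union {m n : ℕ} {S : Fin (m + 1) → SubTy A} {S' : Fin (n + 1) → SubTy A}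
      (f : Fin (m + 1) → Fin (n + 1)) :
      (∀ i, SubLe (S i) (S' (f i))) → ULe (UTy.union m S) (UTy.union n S')

end

/-- What is assigned by a typing judgement: a type `T` to a term, the special type `⊥⊥` to a
jump. -/
inductive Res (A : Type u) : Srt → Type u
  | ty : UTy A → Res A Srt.term
  | bot : Res A Srt.jump

/-- Typing judgements `Γ ⊢ M : ρ | Δ`. The environments `Γ` (for the ordinary variables) and `Δ`
(for the continuation variables) are finite sequences, indexed by the variables. The rule
`same` expresses that syntactically equal expressions are not distinguished. -/
inductive Typing {A : Type u} :
    List (SubTy A) → List (UTy A) → ∀ s : Srt, Exp s → Res A s → Prop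
  | var {Γ : List (SubTy A)} {Δ : List (UTy A)} {x : ℕ} {S : SubTy A} :
      Γ[x]? = some S → Typing Γ Δ Srt.term (var x) (Res.ty (UTy.ofSub S))
  | lam {Γ : List (SubTy A)} {Δ : List (UTy A)} {M : Term} {n : ℕ}
      {S : Fin (n + 1) → SubTy A} {T : Fin (n + 1) → UTy A} :
      (∀ i, Typing (S i :: Γ) Δ Srt.term M (Res.ty (T i))) →
      Typing Γ Δ Srt.term (lam M)
        (Res.ty (UTy.ofSub (SubTy.inter n (fun i => RawTy.arr (S i) (T i)))))
  | app {Γ : List (SubTy A)} {Δ : List (UTy A)} {M N : Term} {n : ℕ}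
      {m : Fin (n + 1) → ℕ} {S : ∀ i : Fin (n + 1), Fin (m i + 1) → SubTy A} {T : UTy A} :
      Typing Γ Δ Srt.term M
        (Res.ty (UTy.union n (fun i => SubTy.inter (m i) (fun j => RawTy.arr (S i j) T)))) →
      (∀ i, Typing Γ Δ Srt.term N (Res.ty (UTy.union (m i) (S i)))) →
      Typing Γ Δ Srt.term (app M N) (Res.ty T)
  | lett {Γ : List (SubTy A)} {Δ : List (UTy A)} {s : Srt} {L : Exp s} {N : Term}
      {ρ : Res A s} {n : ℕ} {S : Fin (n + 1) → SubTy A} :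
      (∀ i, Typing (S i :: Γ) Δ s L ρ) →
      Typing Γ Δ Srt.term N (Res.ty (UTy.union n S)) →
      Typing Γ Δ s (lett L N) ρ
  | mu {Γ : List (SubTy A)} {Δ : List (UTy A)} {J : Jump} {T : UTy A} :
      Typing Γ (T :: Δ) Srt.jump J Res.bot → Typing Γ Δ Srt.term (mu J) (Res.ty T)
  | jmp {Γ : List (SubTy A)} {Δ : List (UTy A)} {k : ℕ} {M : Term} {T : UTy A} :
      Δ[k]? = some T → Typing Γ Δ Srt.term M (Res.ty T) →
      Typing Γ Δ Srt.jump (jmp k M) Res.bot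
  | sub {Γ : List (SubTy A)} {Δ : List (UTy A)} {M : Term} {T T' : UTy A} :
      Typing Γ Δ Srt.term M (Res.ty T) → ULe T T' → Typing Γ Δ Srt.term M (Res.ty T')
  | same {Γ : List (SubTy A)} {Δ : List (UTy A)} {s : Srt} {M M' : Exp s} {ρ : Res A s} :
      Same s M M' → Typing Γ Δ s M ρ → Typing Γ Δ s M' ρ

/-- `M` is typeable, over the atomic types `A`: some judgement `Γ ⊢ M : T | Δ` is derivable. -/
def Typeable (A : Type u) (M : Term) : Prop :=
  ∃ (Γ : List (SubTy A)) (Δ : List (UTy A)) (T : UTy A), Typing Γ Δ Srt.term M (Res.ty T)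

end CCV

/-! ## The lambda calculus with the dot operator -/

namespace DotLam

/-- Lambda terms with a binary operator `dot`, in de Bruijn notation. -/
inductive Tm : Type
  | var : ℕ → Tm
  | lam : Tm → Tm
  | app : Tm → Tm → Tm
  | dot : Tm → Tm → Tm

namespace Tm

/-- Renaming of variables. -/
def ren : (ρ : ℕ → ℕ) → Tm → Tm
  | ρ, var n => var (ρ n)
  | ρ, lam M => lam (ren (CCV.up ρ) M)
  | ρ, app M N => app (ren ρ M) (ren ρ N)
  | ρ, dot M N => dot (ren ρ M) (ren ρ N)

/-- Weakening by a fresh variable, which gets index `0`. -/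
def shift (M : Tm) : Tm := ren Nat.succ M

/-- A substitution pushed under a binder. -/
def upSubst (σ : ℕ → Tm) : ℕ → Tm
  | 0 => var 0
  | n + 1 => shift (σ n)

/-- Simultaneous capture-avoiding substitution. -/
def subst : (σ : ℕ → Tm) → Tm → Tm
  | σ, var n => σ n
  | σ, lam M => lam (subst (upSubst σ) M)
  | σ, app M N => app (subst σ M) (subst σ N)
  | σ, dot M N => dot (subst σ M) (subst σ N)

/-- The substitution of `N` for the variable `0`; the other indices go down by one. -/
def single (N : Tm) : ℕ → Tm
  | 0 => N
  | n + 1 => var n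

end Tm

open Tm

/-- Closure of a relation under all contexts. -/
inductive Compat (R : Tm → Tm → Prop) : Tm → Tm → Prop
  | root {M N : Tm} : R M N → Compat R M N
  | lam {M M' : Tm} : Compat R M M' → Compat R (lam M) (lam M')
  | appL {M M' N : Tm} : Compat R M M' → Compat R (app M N) (app M' N)
  | appR {M N N' : Tm} : Compat R N N' → Compat R (app M N) (app M N')
  | dotL {M M' N : Tm} : Compat R M M' → Compat R (dot M N) (dot M' N)
  | dotR {M N N' : Tm} : Compat R N N' → Compat R (dot M N) (dot M N')

/-- The associativity axiom for the dot operator. -/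
inductive AssocAx : Tm → Tm → Prop
  | dot (L M N : Tm) : AssocAx (dot (dot L M) N) (dot L (dot M N))

/-- Syntactic equality: the congruence generated by associativity of the dot operator. -/
def Same : Tm → Tm → Prop := Relation.EqvGen (Compat AssocAx)

/-- The reduction rules: beta, eta, and `M · N → N`. -/
inductive Rule : Tm → Tm → Prop
  | beta (M N : Tm) : Rule (app (lam M) N) (subst (single N) M)
  | eta (M : Tm) : Rule (lam (app (shift M) (var 0))) M
  | dot (M N : Tm) : Rule (dot M N) N

/-- One-step reduction of terms taken up to syntactic equality. -/
def Step (M N : Tm) : Prop :=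
  ∃ M' N' : Tm, Same M M' ∧ Compat Rule M' N' ∧ Same N' N

/-- Strong normalizability: every reduction sequence from `M` is finite. -/
def StronglyNormalizable (M : Tm) : Prop := Acc (fun N P : Tm => Step P N) M

mutual

/-- Strict types `σ ::= ⊥⊥ | α | τ → σ`; `⊥⊥` is the special atomic type. -/
inductive STy (A : Type u) : Type u
  | bot : STy A
  | atom : A → STy A
  | arr : ITy A → STy A → STy A

/-- Types: nonempty finite intersections `τ ::= σ₀ ∩ ⋯ ∩ σₙ` of strict types. -/
inductive ITy (A : Type u) : Type u
  | inter : (n : ℕ) → (Fin (n + 1) → STy A) → ITy A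

end

mutual

/-- Subtyping between strict types. -/
inductive SLe {A : Type u} : STy A → STy A → Prop
  | bot : SLe STy.bot STy.bot
  | atom (a : A) : SLe (STy.atom a) (STy.atom a)
  | arr {τ τ' : ITy A} {σ σ' : STy A} :
      ILe τ' τ → SLe σ σ' → SLe (STy.arr τ σ) (STy.arr τ' σ')

/-- Subtyping between intersections: each component on the right is above some component on
the left. -/
inductive ILe {A : Type u} : ITy A → ITy A → Prop
  | inter {m n : ℕ} {σ : Fin (m + 1) → STy A} {σ' : Fin (n + 1) → STy A}
      (f : Fin (n + 1) → Fin (m + 1)) :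
      (∀ j, SLe (σ (f j)) (σ' j)) → ILe (ITy.inter m σ) (ITy.inter n σ')

end

/-- Typing judgements `Γ ⊢ₛ M : σ`: intersection type assignment without the empty
intersection, with the inheritance rule and the rule for the dot operator. The rule `same`
expresses that syntactically equal terms are not distinguished. -/
inductive Typing {A : Type u} : List (ITy A) → Tm → STy A → Prop
  | var {Γ : List (ITy A)} {x n : ℕ} {σ : Fin (n + 1) → STy A} (i : Fin (n + 1)) :
      Γ[x]? = some (ITy.inter n σ) → Typing Γ (var x) (σ i)
  | lam {Γ : List (ITy A)} {M : Tm} {τ : ITy A} {σ : STy A} :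
      Typing (τ :: Γ) M σ → Typing Γ (lam M) (STy.arr τ σ)
  | app {Γ : List (ITy A)} {M N : Tm} {n : ℕ} {σ : Fin (n + 1) → STy A} {σ' : STy A} :
      Typing Γ M (STy.arr (ITy.inter n σ) σ') → (∀ i, Typing Γ N (σ i)) →
      Typing Γ (app M N) σ'
  | dot {Γ : List (ITy A)} {M N : Tm} :
      Typing Γ M STy.bot → Typing Γ N STy.bot → Typing Γ (dot M N) STy.bot
  | sub {Γ : List (ITy A)} {M : Tm} {σ σ' : STy A} :
      Typing Γ M σ → SLe σ σ' → Typing Γ M σ'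
  | same {Γ : List (ITy A)} {M M' : Tm} {σ : STy A} :
      Same M M' → Typing Γ M σ → Typing Γ M' σ

end DotLam

-- Dot calculus: reducibility on raw terms, and passage to the quotient by associativity

namespace DotLam

open Tm Relation

/-! ### Renaming and substitution -/

-- Both statements rest on one reducibility argument for raw dot terms, in which associativity of
-- the dot is not quotiented out but oriented to the right and counted as a reduction (`Red`). Types
-- are interpreted by candidates in the style of Girard; the closure property specific to the dot is
-- that products of strongly normalizing terms are strongly normalizing (`SN.dot`). For the dot
-- calculus itself, `nest` selects the right-nested representative of each associativity class:
-- congruent terms have equal representatives, a step of the quotient calculus becomes at least one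
-- `Red` step between representatives (`redp_nest_of_step`), and the representative of a typed term
-- is reducible (`sem_subst_nest`).
--
-- CCV expressions are mapped to dot terms by continuation passing. A plain CPS translation would
-- not be strict: a μ may discard its continuation together with the reductions inside it, and
-- several rules would become identities. Therefore a continuation is passed as a pair of `K` and a
-- guard `G`, where `G` is a reduct of `K` applied to a dummy value. The translation of a term never
-- erases its guard (`tr_redp_cont`), and the guard of a let frame is the body with the dummy for
-- the bound variable, so reductions in the body survive. The products `G · _` moreover supply
-- steps, dropping or reassociating, to rules that would otherwise collapse. The translation is
-- literally invariant under syntactic equality (`Same.tr_eq`) and sends each CCV step to at least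
-- one dot step (`redp_of_step`).
--
-- It remains to normalize the translations. An arrow `S → T` becomes `¬T → S → ⊥⊥`, and a union
-- becomes, in continuation position, the intersection of the negated members. Instead of typing the
-- translated term, `sn_tr_of_typing` shows by induction on the CCV derivation that the translation
-- is strongly normalizing as soon as values and continuations lie in the candidates of their types
-- and guards are strongly normalizing.

theorem up_comp (ρ ρ' : ℕ → ℕ) : CCV.up ρ ∘ CCV.up ρ' = CCV.up (ρ ∘ ρ') := by
  funext n; cases n <;> rfl

theorem ren_ren (ρ ρ' : ℕ → ℕ) (M : Tm) : ren ρ (ren ρ' M) = ren (ρ ∘ ρ') M := by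
  induction M generalizing ρ ρ' with
  | var n => rfl
  | lam M ih => simp [ren, ih, up_comp]
  | app M N ih1 ih2 => simp [ren, ih1, ih2]
  | dot M N ih1 ih2 => simp [ren, ih1, ih2]

theorem subst_ren (σ : ℕ → Tm) (ρ : ℕ → ℕ) (M : Tm) : subst σ (ren ρ M) = subst (σ ∘ ρ) M := by
  induction M generalizing σ ρ with
  | var n => rfl
  | lam M ih =>
    have : upSubst σ ∘ CCV.up ρ = upSubst (σ ∘ ρ) := by funext n; cases n <;> rfl
    simp [ren, subst, ih, this]
  | app M N ih1 ih2 => simp [ren, subst, ih1, ih2]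
  | dot M N ih1 ih2 => simp [ren, subst, ih1, ih2]

theorem ren_shift (ρ : ℕ → ℕ) (M : Tm) : ren (CCV.up ρ) (shift M) = shift (ren ρ M) := by
  simp only [shift, ren_ren]; rfl

theorem ren_subst (σ : ℕ → Tm) (ρ : ℕ → ℕ) (M : Tm) :
    ren ρ (subst σ M) = subst (fun n => ren ρ (σ n)) M := by
  induction M generalizing σ ρ with
  | var n => rfl
  | lam M ih =>
    have : (fun n => ren (CCV.up ρ) (upSubst σ n)) = upSubst (fun n => ren ρ (σ n)) := by
      funext n
      cases n with
      | zero => rfl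
      | succ n => exact ren_shift ρ (σ n)
    simp [ren, subst, ih, this]
  | app M N ih1 ih2 => simp [ren, subst, ih1, ih2]
  | dot M N ih1 ih2 => simp [ren, subst, ih1, ih2]

theorem subst_shift (σ : ℕ → Tm) (M : Tm) : subst (upSubst σ) (shift M) = shift (subst σ M) := by
  simp only [shift, subst_ren, ren_subst]; rfl

theorem subst_subst (σ τ : ℕ → Tm) (M : Tm) :
    subst σ (subst τ M) = subst (fun n => subst σ (τ n)) M := by
  induction M generalizing σ τ with
  | var n => rfl
  | lam M ih =>
    have : (fun n => subst (upSubst σ) (upSubst τ n)) = upSubst (fun n => subst σ (τ n)) := by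
      funext n
      cases n with
      | zero => rfl
      | succ n => exact subst_shift σ (τ n)
    simp [subst, ih, this]
  | app M N ih1 ih2 => simp [subst, ih1, ih2]
  | dot M N ih1 ih2 => simp [subst, ih1, ih2]

theorem upSubst_var : upSubst var = var := by
  funext n; cases n <;> rfl

theorem subst_var (M : Tm) : subst var M = M := by
  induction M with
  | var n => rfl
  | lam M ih => simp [subst, upSubst_var, ih]
  | app M N ih1 ih2 => simp [subst, ih1, ih2]
  | dot M N ih1 ih2 => simp [subst, ih1, ih2]

theorem ren_eq_subst (ρ : ℕ → ℕ) (M : Tm) : ren ρ M = subst (fun n => var (ρ n)) M := by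
  have := subst_ren var ρ M
  rw [subst_var] at this
  exact this

theorem subst_single_shift (N M : Tm) : subst (single N) (shift M) = M := by
  rw [shift, subst_ren]; exact subst_var M

theorem subst_subst_single (σ : ℕ → Tm) (M N : Tm) :
    subst σ (subst (single N) M) = subst (single (subst σ N)) (subst (upSubst σ) M) := by
  rw [subst_subst, subst_subst]
  congr 1; funext n
  cases n with
  | zero => rfl
  | succ n => exact (subst_single_shift _ _).symm

/-! ### Reduction with oriented associativity -/

/-- One-step reduction of raw terms: the reduction rules, and associativity of the dot operator
oriented to the right. -/
def Red : Tm → Tm → Prop := Compat (fun M N => Rule M N ∨ AssocAx M N)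

/-- Reduction in any number of steps. -/
abbrev Reds : Tm → Tm → Prop := ReflTransGen Red

/-- Reduction in at least one step. -/
abbrev Redp : Tm → Tm → Prop := TransGen Red

namespace Red

theorem beta (M N : Tm) : Red (app (lam M) N) (subst (single N) M) := .root (.inl (.beta M N))
theorem eta (M : Tm) : Red (lam (app (shift M) (var 0))) M := .root (.inl (.eta M))
theorem drop (M N : Tm) : Red (dot M N) N := .root (.inl (.dot M N))
theorem assoc (L M N : Tm) : Red (dot (dot L M) N) (dot L (dot M N)) :=
  .root (.inr (.dot L M N))

theorem subst {M N : Tm} (h : Red M N) (σ : ℕ → Tm) : Red (M.subst σ) (N.subst σ) := by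
  induction h generalizing σ with
  | @root _ N h =>
    rcases h with h | h
    · cases h with
      | beta M N => rw [subst_subst_single]; exact beta _ _
      | eta _ =>
        have := eta (N.subst σ)
        rw [← subst_shift] at this
        exact this
      | dot M N => exact drop _ _
    · cases h; exact assoc _ _ _
  | lam _ ih => exact .lam (ih _)
  | appL _ ih => exact .appL (ih _)
  | appR _ ih => exact .appR (ih _)
  | dotL _ ih => exact .dotL (ih _)
  | dotR _ ih => exact .dotR (ih _)

theorem ren {M N : Tm} (h : Red M N) (ρ : ℕ → ℕ) : Red (M.ren ρ) (N.ren ρ) := by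
  rw [ren_eq_subst, ren_eq_subst]; exact h.subst _

end Red

namespace Reds

theorem lam {M M' : Tm} (h : Reds M M') : Reds (.lam M) (.lam M') :=
  ReflTransGen.lift _ (fun _ _ h => .lam h) _ _ h
theorem app {M M' N N' : Tm} (h : Reds M M') (h' : Reds N N') :
    Reds (.app M N) (.app M' N') :=
  (ReflTransGen.lift (Tm.app · N) (fun _ _ h => .appL h) _ _ h).trans
    (ReflTransGen.lift (Tm.app M' ·) (fun _ _ h => .appR h) _ _ h')
theorem dot {M M' N N' : Tm} (h : Reds M M') (h' : Reds N N') :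
    Reds (.dot M N) (.dot M' N') :=
  (ReflTransGen.lift (Tm.dot · N) (fun _ _ h => .dotL h) _ _ h).trans
    (ReflTransGen.lift (Tm.dot M' ·) (fun _ _ h => .dotR h) _ _ h')
theorem subst {M M' : Tm} (h : Reds M M') (σ : ℕ → Tm) : Reds (M.subst σ) (M'.subst σ) :=
  ReflTransGen.lift _ (fun _ _ h => h.subst σ) _ _ h
theorem shift {M M' : Tm} (h : Reds M M') : Reds M.shift M'.shift :=
  ReflTransGen.lift _ (fun _ _ h => h.ren _) _ _ h

theorem subst_right {σ σ' : ℕ → Tm} (h : ∀ n, Reds (σ n) (σ' n)) (M : Tm) :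
    Reds (M.subst σ) (M.subst σ') := by
  induction M generalizing σ σ' with
  | var n => exact h n
  | lam M ih =>
    refine lam (ih fun n => ?_)
    cases n with
    | zero => exact .refl
    | succ n => exact (h n).shift
  | app M N ih1 ih2 => exact app (ih1 h) (ih2 h)
  | dot M N ih1 ih2 => exact dot (ih1 h) (ih2 h)

theorem single_right {N N' : Tm} (h : Reds N N') (M : Tm) :
    Reds (M.subst (single N)) (M.subst (single N')) :=
  subst_right (fun n => by cases n <;> [exact h; exact .refl]) M

end Reds

namespace Redp

theorem lam {M M' : Tm} (h : Redp M M') : Redp (.lam M) (.lam M') :=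
  TransGen.lift _ (fun _ _ h => .lam h) _ _ h
theorem appL {M M' N N' : Tm} (h : Redp M M') (h' : Reds N N') :
    Redp (.app M N) (.app M' N') :=
  (TransGen.lift (Tm.app · N) (fun _ _ h => .appL h) _ _ h).trans_left (Reds.app .refl h')
theorem appR {M M' N N' : Tm} (h : Reds M M') (h' : Redp N N') :
    Redp (.app M N) (.app M' N') :=
  TransGen.trans_right (Reds.app h .refl) (TransGen.lift (Tm.app M' ·) (fun _ _ h => .appR h) _ _ h')
theorem dotL {M M' N N' : Tm} (h : Redp M M') (h' : Reds N N') :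
    Redp (.dot M N) (.dot M' N') :=
  (TransGen.lift (Tm.dot · N) (fun _ _ h => .dotL h) _ _ h).trans_left (Reds.dot .refl h')
theorem dotR {M M' N N' : Tm} (h : Reds M M') (h' : Redp N N') :
    Redp (.dot M N) (.dot M' N') :=
  TransGen.trans_right (Reds.dot h .refl) (TransGen.lift (Tm.dot M' ·) (fun _ _ h => .dotR h) _ _ h')

end Redp

/-! ### Strong normalization of raw terms -/

/-- Strong normalizability for the reduction of raw terms. -/
def SN (M : Tm) : Prop := Acc (fun N P : Tm => Red P N) M

namespace SN

theorem red {M N : Tm} (h : SN M) (r : Red M N) : SN N := h.inv r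

theorem reds {M N : Tm} (h : SN M) (r : Reds M N) : SN N := by
  induction r with
  | refl => exact h
  | tail _ r ih => exact ih.red r

/-- An infinite reduction from `M` would be carried by `f` to one from `f M`. -/
theorem of_map {f : Tm → Tm} (hf : ∀ M N, Red M N → Red (f M) (f N)) {M : Tm} (h : SN (f M)) :
    SN M := by
  generalize hP : f M = P at h
  induction h generalizing M with
  | intro P _ ih => subst hP; exact ⟨_, fun N r => ih _ (hf _ _ r) rfl⟩

theorem of_appL {M N : Tm} (h : SN (app M N)) : SN M := of_map (fun _ _ => .appL) h
theorem of_subst {M : Tm} {σ : ℕ → Tm} (h : SN (M.subst σ)) : SN M :=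
  of_map (fun _ _ r => r.subst σ) h
theorem of_dotR {M N : Tm} (h : SN (dot M N)) : SN N := of_map (fun _ _ => .dotR) h

/-- Reduction together with passing to a component of a dot term is well-founded on strongly
normalizing terms. -/
theorem acc_component {M : Tm} (h : SN M) :
    Acc (fun N P : Tm => Red P N ∨ ∃ Q, P = dot N Q ∨ P = dot Q N) M := by
  -- Generalized to `P` inside a reduction-preserving context `C`: on passing to a component, `C`
  -- absorbs the other factor, so the filled term stays the same strongly normalizing term and
  -- induction on `P` applies.
  suffices H : ∀ M, SN M → ∀ (C : Tm → Tm), (∀ P Q, Red P Q → Red (C P) (C Q)) →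
      ∀ P, C P = M → Acc (fun N P : Tm => Red P N ∨ ∃ Q, P = dot N Q ∨ P = dot Q N) P from
    H M h id (fun _ _ r => r) M rfl
  intro M h
  induction h with
  | intro M _ ih =>
    intro C hC P hP
    induction P generalizing C with
    | var n =>
      refine ⟨_, ?_⟩
      rintro N (r | ⟨Q, h | h⟩)
      · exact ih _ (hP ▸ hC _ _ r) C hC N rfl
      all_goals cases h
    | lam P =>
      refine ⟨_, ?_⟩
      rintro N (r | ⟨Q, h | h⟩)
      · exact ih _ (hP ▸ hC _ _ r) C hC N rfl
      all_goals cases h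
    | app P P' =>
      refine ⟨_, ?_⟩
      rintro N (r | ⟨Q, h | h⟩)
      · exact ih _ (hP ▸ hC _ _ r) C hC N rfl
      all_goals cases h
    | dot P P' ih1 ih2 =>
      refine ⟨_, ?_⟩
      rintro N (r | ⟨Q, h | h⟩)
      · exact ih _ (hP ▸ hC _ _ r) C hC N rfl
      · cases h
        exact ih1 (fun X => C (Tm.dot X P')) (fun _ _ r => hC _ _ (.dotL r)) hP
      · cases h
        exact ih2 (fun X => C (Tm.dot P X)) (fun _ _ r => hC _ _ (.dotR r)) hP

/-- The delicate step is `(A · B) · N → A · (B · N)`: the left factor becomes a component of the old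
one while the right factor grows. Hence the outer induction is on reduction or passage to a
component of `M`, with `N` arbitrary, and the inner one on `N`. -/
theorem dot {M N : Tm} (hM : SN M) (hN : SN N) : SN (dot M N) := by
  have := hM.acc_component
  clear hM
  induction this generalizing N with
  | intro M _ ihM =>
    have hN' := hN
    induction hN with
    | intro N _ ihN =>
      refine ⟨_, fun P r => ?_⟩
      cases r with
      | root h =>
        rcases h with h | h
        · cases h; exact hN'
        · cases h with
          | dot A B =>
            exact ihM A (.inr ⟨B, .inl rfl⟩) (ihM B (.inr ⟨A, .inr rfl⟩) hN')
      | dotL r => exact ihM _ (.inl r) hN'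
      | dotR r => exact ihN _ r (hN'.red r)

end SN

/-! ### Reducibility -/

mutual

/-- The interpretation of strict types as sets of strongly normalizing terms. -/
def STy.sem {A : Type u} : STy A → Tm → Prop
  | .bot, M => SN M
  | .atom _, M => SN M
  | .arr τ σ, M => ∀ N, ITy.sem τ N → STy.sem σ (app M N)

/-- The interpretation of intersection types. -/
def ITy.sem {A : Type u} : ITy A → Tm → Prop
  | .inter _ σ, M => ∀ i, STy.sem (σ i) M

end

/-- Terms which do not form a redex when applied. -/
def Neutral (M : Tm) : Prop := ∀ P, M ≠ lam P

/-- The three properties of a set of reducible terms. -/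
structure IsCandidate (X : Tm → Prop) : Prop where
  sn : ∀ M, X M → SN M
  red : ∀ M N, X M → Red M N → X N
  neutral : ∀ M, Neutral M → (∀ N, Red M N → X N) → X M

theorem IsCandidate.var {X : Tm → Prop} (h : IsCandidate X) (n : ℕ) : X (var n) :=
  h.neutral _ (fun _ h => by cases h) fun N r => by
    cases r with
    | root h => rcases h with h | h <;> cases h

theorem IsCandidate.reds {X : Tm → Prop} (hX : IsCandidate X) {M N : Tm} (h : X M)
    (r : Reds M N) : X N := by
  induction r with
  | refl => exact h
  | tail _ r ih => exact hX.red _ _ ih r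

theorem isCandidate_sn : IsCandidate SN :=
  ⟨fun _ h => h, fun _ _ h r => h.red r, fun _ _ h => ⟨_, h⟩⟩

theorem IsCandidate.arr {X Y : Tm → Prop} (hX : IsCandidate X) (hY : IsCandidate Y) :
    IsCandidate (fun M => ∀ N, X N → Y (app M N)) where
  sn _ h := (hY.sn _ (h _ (hX.var 0))).of_appL
  red _ _ h r P hP := hY.red _ _ (h P hP) (.appL r)
  neutral M hM h N hN := by
    have hs := hX.sn _ hN
    induction hs with
    | intro N _ ih =>
      refine hY.neutral _ (fun _ h => by cases h) fun P r => ?_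
      cases r with
      | root h =>
        rcases h with h | h
        · cases h; exact absurd rfl (hM _)
        · cases h
      | appL r => exact h _ r _ hN
      | appR r => exact ih _ r (hX.red _ _ hN r)

theorem IsCandidate.inter {n : ℕ} {X : Fin (n + 1) → Tm → Prop} (h : ∀ i, IsCandidate (X i)) :
    IsCandidate (fun M => ∀ i, X i M) where
  sn _ hM := (h 0).sn _ (hM 0)
  red _ _ hM r i := (h i).red _ _ (hM i) r
  neutral _ hM hr i := (h i).neutral _ hM fun N r => hr N r i

mutual

theorem STy.sem_isCandidate {A : Type u} : ∀ σ : STy A, IsCandidate σ.sem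
  | .bot => by simpa only [STy.sem] using isCandidate_sn
  | .atom _ => by simpa only [STy.sem] using isCandidate_sn
  | .arr τ σ => by
    have := (ITy.sem_isCandidate τ).arr (STy.sem_isCandidate σ)
    simpa only [STy.sem] using this

theorem ITy.sem_isCandidate {A : Type u} : ∀ τ : ITy A, IsCandidate τ.sem
  | .inter _ σ => by
    have := IsCandidate.inter fun i => STy.sem_isCandidate (σ i)
    simpa only [ITy.sem] using this

end

/-- Since the application is neutral, it suffices to treat its one-step reducts, by induction on `P`
and then on `N`. -/
theorem IsCandidate.app_lam {X : Tm → Prop} (hX : IsCandidate X) {P N : Tm} (hN : SN N)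
    (h : X (P.subst (single N))) : X (app (lam P) N) := by
  have hP : SN P := (hX.sn _ h).of_subst
  induction hP generalizing N with
  | intro P _ ihP =>
    have hN' := hN
    induction hN with
    | intro N _ ihN =>
      refine hX.neutral _ (fun _ h => by cases h) fun Q r => ?_
      cases r with
      | root h' =>
        rcases h' with h' | h'
        · cases h'; exact h
        · cases h'
      | appL r =>
        cases r with
        | root h' =>
          rcases h' with h' | h'
          · cases h' with
            | eta Q =>
              simp only [subst, subst_single_shift] at h
              exact h
          · cases h'
        | lam r => exact ihP _ r hN' (hX.red _ _ h (Red.subst r _))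
      | appR r =>
        refine ihN _ r ?_ (hN'.red r)
        exact hX.reds h (Reds.single_right (.single r) P)

theorem SLe.sem {A : Type u} {σ σ' : STy A} (h : SLe σ σ') : ∀ M, σ.sem M → σ'.sem M := by
  refine SLe.rec (motive_1 := fun σ σ' _ => ∀ M, σ.sem M → σ'.sem M)
    (motive_2 := fun τ τ' _ => ∀ M, τ.sem M → τ'.sem M) ?_ ?_ ?_ ?_ h
  · exact fun _ h => h
  · exact fun _ _ h => h
  · intro _ _ _ _ _ _ ih1 ih2 M hM
    simp only [STy.sem] at hM ⊢
    exact fun N hN => ih2 _ (hM N (ih1 N hN))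
  · intro _ _ _ _ f _ ih M hM
    simp only [ITy.sem] at hM ⊢
    exact fun j => ih j M (hM (f j))

theorem ILe.sem {A : Type u} {τ τ' : ITy A} (h : ILe τ τ') (M : Tm) (hM : τ.sem M) :
    τ'.sem M := by
  cases h with
  | inter f h =>
    simp only [ITy.sem] at hM ⊢
    exact fun j => (h j).sem M (hM (f j))

/-! ### Right-nested normal form with respect to associativity -/

/-- The dot product `M · N`, with the dots of `M` nested to the right. -/
def dapp : Tm → Tm → Tm
  | dot M N, P => dot M (dapp N P)
  | var n, P => dot (var n) P
  | lam M, P => dot (lam M) P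
  | app M N, P => dot (app M N) P

/-- All dots nested to the right. -/
def nest : Tm → Tm
  | var n => var n
  | lam M => lam (nest M)
  | app M N => app (nest M) (nest N)
  | dot M N => dapp (nest M) (nest N)

theorem dapp_assoc (L M N : Tm) : dapp (dapp L M) N = dapp L (dapp M N) := by
  induction L with
  | dot _ _ _ ih => simp only [dapp, ih]
  | _ => rfl

theorem reds_dapp (M N : Tm) : Reds (dot M N) (dapp M N) := by
  induction M with
  | dot A B _ ih => exact .head (.assoc _ _ _) (Reds.dot .refl ih)
  | _ => exact .refl

theorem redp_dapp_drop (M N : Tm) : Redp (dapp M N) N := by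
  induction M with
  | dot A B _ ih => exact .head (.drop _ _) ih
  | _ => exact .single (.drop _ _)

theorem Red.dapp_right {N N' : Tm} (h : Red N N') (M : Tm) : Red (dapp M N) (dapp M N') := by
  induction M with
  | dot A B _ ih => exact .dotR ih
  | _ => exact .dotR h

/-- Several steps may be needed: a factor that is not a product can reduce to a product, which must
then be nested again. -/
theorem Red.dapp_left {M M' : Tm} (h : Red M M') (N : Tm) : Redp (dapp M N) (dapp M' N) := by
  have atom : ∀ {M M' : Tm}, Red M M' → Redp (dot M N) (dapp M' N) := fun r =>
    TransGen.head' (.dotL r) (reds_dapp _ _)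
  induction M generalizing M' with
  | dot A B _ ih =>
    cases h with
    | root h =>
      rcases h with h | h
      · cases h; exact .single (.drop _ _)
      · cases h; exact .single (.assoc _ _ _)
    | dotL r => exact .single (.dotL r)
    | dotR r => exact Redp.dotR .refl (ih r)
  | _ => exact atom h

theorem Reds.dapp {M M' N N' : Tm} (h : Reds M M') (h' : Reds N N') :
    Reds (dapp M N) (dapp M' N') := by
  refine ReflTransGen.trans (b := DotLam.dapp M' N) ?_
    (ReflTransGen.lift (DotLam.dapp M' ·) (fun _ _ r => r.dapp_right _) _ _ h')
  induction h with
  | refl => exact .refl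
  | tail _ r ih => exact ih.trans (r.dapp_left N).to_reflTransGen

theorem Redp.dapp_left {M M' : Tm} (h : Redp M M') (N : Tm) : Redp (dapp M N) (dapp M' N) := by
  induction h with
  | single r => exact r.dapp_left N
  | tail _ r ih => exact ih.trans (r.dapp_left N)

theorem dapp_ren (ρ : ℕ → ℕ) (M N : Tm) : ren ρ (dapp M N) = dapp (ren ρ M) (ren ρ N) := by
  induction M with
  | dot A B _ ih => simp only [dapp, ren, ih]
  | _ => rfl

theorem nest_ren (ρ : ℕ → ℕ) (M : Tm) : nest (ren ρ M) = ren ρ (nest M) := by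
  induction M generalizing ρ with
  | var n => rfl
  | lam M ih => simp only [nest, ren, ih]
  | app M N ih1 ih2 => simp only [nest, ren, ih1, ih2]
  | dot M N ih1 ih2 => simp only [nest, ren, ih1, ih2, dapp_ren]

theorem reds_subst_dapp (σ : ℕ → Tm) (M N : Tm) :
    Reds (subst σ (dapp M N)) (dapp (subst σ M) (subst σ N)) := by
  induction M with
  | dot A B _ ih => exact Reds.dot .refl ih
  | _ => exact reds_dapp _ _

/-- Not an equality: substituting a product for the left factor of a dot creates a left nesting,
which oriented associativity removes. -/
theorem reds_subst_nest (σ : ℕ → Tm) (M : Tm) :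
    Reds (subst (fun n => nest (σ n)) (nest M)) (nest (subst σ M)) := by
  induction M generalizing σ with
  | var n => exact .refl
  | lam M ih =>
    refine Reds.lam ?_
    have : upSubst (fun n => nest (σ n)) = fun n => nest (upSubst σ n) := by
      funext n
      cases n with
      | zero => rfl
      | succ n => exact (nest_ren _ _).symm
    rw [this]
    exact ih _
  | app M N ih1 ih2 => exact Reds.app (ih1 σ) (ih2 σ)
  | dot M N ih1 ih2 => exact (reds_subst_dapp _ _ _).trans (Reds.dapp (ih1 σ) (ih2 σ))

theorem Same.nest_eq {M N : Tm} (h : Same M N) : nest M = nest N := by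
  induction h with
  | rel M N h =>
    induction h with
    | root h => cases h; exact dapp_assoc _ _ _
    | lam _ ih => simp only [nest, ih]
    | appL _ ih => simp only [nest, ih]
    | appR _ ih => simp only [nest, ih]
    | dotL _ ih => simp only [nest, ih]
    | dotR _ ih => simp only [nest, ih]
  | refl => rfl
  | symm _ _ _ ih => exact ih.symm
  | trans _ _ _ _ _ ih1 ih2 => exact ih1.trans ih2

theorem redp_nest_of_compat {M N : Tm} (h : Compat Rule M N) : Redp (nest M) (nest N) := by
  induction h with
  | @root _ N h =>
    cases h with
    | beta M N =>
      refine TransGen.head' (Red.beta _ _) ?_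
      have := reds_subst_nest (single N) M
      have e : (fun n => nest (single N n)) = single (nest N) := by
        funext n; cases n <;> rfl
      rwa [e] at this
    | eta _ =>
      have := Red.eta (nest N)
      rw [shift, ← nest_ren] at this
      exact .single this
    | dot M N => exact redp_dapp_drop _ _
  | lam _ ih => exact Redp.lam ih
  | appL _ ih => exact Redp.appL ih .refl
  | appR _ ih => exact Redp.appR .refl ih
  | dotL _ ih => exact ih.dapp_left _
  | @dotR M _ _ _ ih =>
    exact TransGen.lift (dapp (nest M) ·) (fun _ _ r => r.dapp_right _) _ _ ih

theorem redp_nest_of_step {M N : Tm} (h : Step M N) : Redp (nest M) (nest N) := by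
  obtain ⟨M', N', h1, h2, h3⟩ := h
  rw [h1.nest_eq, ← h3.nest_eq]
  exact redp_nest_of_compat h2

/-- Stated for an arbitrary relation because it serves both calculi, with `f` either `nest` or the
CPS translation. -/
theorem SN.of_redp {α : Type*} {r : α → α → Prop} {f : α → Tm}
    (hf : ∀ a b, r a b → Redp (f a) (f b)) {a : α} (h : SN (f a)) :
    Acc (fun b a => r a b) a := by
  have h' : Acc (fun N P => Redp P N) (f a) := by
    have := Acc.transGen h
    refine Subrelation.accessible ?_ this
    intro N P r
    exact transGen_swap.1 r
  exact Subrelation.accessible (fun {b a} r => hf a b r) (InvImage.accessible f h')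

/-! ### Soundness of the typing rules -/

/-- Fundamental lemma of reducibility. Working with `nest M` makes the rule `same` trivial; the
price is the dot case, where the plain product must be reduced to its nested form. -/
theorem sem_subst_nest {A : Type u} {Γ : List (ITy A)} {M : Tm} {σ : STy A} (h : Typing Γ M σ)
    (φ : ℕ → Tm) (hφ : ∀ (x : ℕ) (τ : ITy A), Γ[x]? = some τ → τ.sem (φ x)) : σ.sem (subst φ (nest M)) := by
  induction h generalizing φ with
  | var i h =>
    have := hφ _ _ h
    simp only [ITy.sem] at this
    exact this i
  | @lam Γ M τ σ _ ih =>
    simp only [STy.sem]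
    intro N hN
    refine (STy.sem_isCandidate σ).app_lam ((ITy.sem_isCandidate τ).sn _ hN) ?_
    rw [subst_subst]
    refine ih _ fun x τ' hx => ?_
    cases x with
    | zero => cases hx; exact hN
    | succ x =>
      have := hφ x τ' hx
      rwa [← subst_single_shift N (φ x)] at this
  | app _ _ ih1 ih2 =>
    have := ih1 φ hφ
    simp only [STy.sem, ITy.sem] at this
    exact this _ fun i => ih2 i φ hφ
  | dot _ _ ih1 ih2 =>
    have h1 := ih1 φ hφ
    have h2 := ih2 φ hφ
    simp only [STy.sem] at h1 h2 ⊢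
    exact SN.reds (h1.dot h2) (Reds.subst (reds_dapp _ _) φ)
  | sub _ hle ih => exact hle.sem _ (ih φ hφ)
  | same hs _ ih => rw [← hs.nest_eq]; exact ih φ hφ

theorem stronglyNormalizable_of_typing {A : Type u} {Γ : List (ITy A)} {M : Tm} {σ : STy A}
    (h : Typing Γ M σ) : StronglyNormalizable M := by
  have := sem_subst_nest h var fun x τ _ => (ITy.sem_isCandidate τ).var x
  rw [subst_var] at this
  exact SN.of_redp (f := nest) (fun _ _ => redp_nest_of_step) ((STy.sem_isCandidate σ).sn _ this)

end DotLam

-- CCV: the guarded CPS translation and its compatibility with the syntax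

namespace CCV

open DotLam (Tm Red Reds Redp SN)

/-! ### Continuation-passing translation into the dot calculus -/

/-- Environments of the translation: a dummy value, and the meaning of the ordinary variables
and of the continuation variables. A continuation is a term together with a term of which it is
guaranteed that its reductions are not erased. -/
structure Env where
  d : Tm
  v : ℕ → Tm
  k : ℕ → Tm × Tm

namespace Env

/-- Extension by a value. -/
def push (E : Env) (V : Tm) : Env := ⟨E.d, fun n => n.casesOn V E.v, E.k⟩

/-- Extension by a continuation. -/
def kpush (E : Env) (K G : Tm) : Env := ⟨E.d, E.v, fun n => n.casesOn (K, G) E.k⟩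

/-- Substitution in all components. -/
def subst (σ : ℕ → Tm) (E : Env) : Env :=
  ⟨E.d.subst σ, fun n => (E.v n).subst σ, fun n => ((E.k n).1.subst σ, (E.k n).2.subst σ)⟩

/-- Weakening of all components. -/
def up (E : Env) : Env :=
  ⟨E.d.shift, fun n => (E.v n).shift, fun n => ((E.k n).1.shift, (E.k n).2.shift)⟩

/-- Precomposition with renamings. -/
def comp (E : Env) (ρ θ : ℕ → ℕ) : Env := ⟨E.d, E.v ∘ ρ, E.k ∘ θ⟩

theorem push_subst (σ : ℕ → Tm) (E : Env) (V : Tm) :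
    (E.push V).subst σ = (E.subst σ).push (V.subst σ) := by
  simp only [subst, push, mk.injEq, true_and, and_true]
  funext n; cases n <;> rfl

theorem kpush_subst (σ : ℕ → Tm) (E : Env) (K G : Tm) :
    (E.kpush K G).subst σ = (E.subst σ).kpush (K.subst σ) (G.subst σ) := by
  simp only [subst, kpush, mk.injEq, true_and]
  funext n; cases n <;> rfl

theorem up_subst (σ : ℕ → Tm) (E : Env) :
    E.up.subst (DotLam.Tm.upSubst σ) = (E.subst σ).up := by
  simp only [subst, up, DotLam.subst_shift]

theorem up_subst_single (V : Tm) (E : Env) : E.up.subst (DotLam.Tm.single V) = E := by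
  simp only [subst, up, DotLam.subst_single_shift]

theorem subst_succ (E : Env) : E.subst (fun n => .var (n + 1)) = E.up := by
  simp only [subst, up, DotLam.Tm.shift, DotLam.ren_eq_subst]

theorem push_up (E : Env) (V : Tm) : (E.push V).up = E.up.push V.shift := by
  simp only [up, push, mk.injEq, true_and, and_true]
  funext n; cases n <;> rfl

theorem kpush_up (E : Env) (K G : Tm) : (E.kpush K G).up = E.up.kpush K.shift G.shift := by
  simp only [up, kpush, mk.injEq, true_and]
  funext n; cases n <;> rfl

theorem push_comp (E : Env) (V : Tm) (ρ θ : ℕ → ℕ) :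
    (E.push V).comp (CCV.up ρ) θ = (E.comp ρ θ).push V := by
  simp only [comp, push, mk.injEq, true_and, and_true]
  funext n; cases n <;> rfl

theorem kpush_comp (E : Env) (K G : Tm) (ρ θ : ℕ → ℕ) :
    (E.kpush K G).comp ρ (CCV.up θ) = (E.comp ρ θ).kpush K G := by
  simp only [comp, kpush, mk.injEq, true_and]
  funext n; cases n <;> rfl

end Env

/-- The meaning of an expression: a function of an environment and a continuation. -/
abbrev Den : Type := Env → Tm → Tm → Tm

/-- The continuation `λx. t`. -/
def frame (t : Den) (E : Env) (K G : Tm) : Tm :=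
  .lam (t (E.up.push (.var 0)) K.shift G.shift)

/-- The application of a value `v` to an expression with meaning `u`; if `b` is true, that
expression is the value `w`. -/
def appVal (b : Bool) (w : Env → Tm) (u : Den) (v : Tm) : Den := fun E K G =>
  if b then .dot G (.app (.app v K) (w E))
  else .dot G (u E (.lam (.dot G.shift (.app (.app v.shift K.shift) (.var 0))))
    (.dot G (.app (.app v K) E.d)))

/-- Decides whether an expression is a value. -/
def isVal : {s : Srt} → Exp s → Bool
  | _, .var _ => true
  | _, .lam _ => true
  | _, _ => false

/-- The meaning of a `λ`-abstraction whose body has the meaning `t`. -/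
def lamVal (t : Den) (E : Env) : Tm :=
  -- The body has the shape of a translated let whose argument is the bound value, so two β-steps
  -- lead from a redex towards the let of `betaLam`. The bound continuation `k` has the guard `k d`.
  .lam (.lam (.dot (t (E.up.up.push E.up.up.d) (.var 1) (.app (.var 1) E.up.up.d))
    (.app (frame t E.up.up (.var 1) (.app (.var 1) E.up.up.d)) (.var 0))))

mutual

/-- The translation of expressions. Jumps ignore the continuation. -/
def tr : {s : Srt} → Exp s → Env → Tm → Tm → Tm
  | _, .var n, E, K, G => .dot G (.app K (E.v n))
  | _, .lam M, E, K, G => .dot G (.app K (lamVal (fun E K G => tr M E K G) E))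
  | _, .app M N, E, K, G =>
    if isVal M then
      appVal (isVal N) (fun E => val N E) (fun E K G => tr N E K G) (val M E) E K G
    else .dot G (tr M E
      (.lam (appVal (isVal N) (fun E => val N E) (fun E K G => tr N E K G) (.var 0)
        E.up K.shift G.shift))
      (appVal (isVal N) (fun E => val N E) (fun E K G => tr N E K G) E.d E K G))
  -- The body occurs twice: in the frame, which `M` may discard, and at the dummy value in the
  -- guard, which `M` keeps.
  | _, .lett L M, E, K, G =>
    tr M E (frame (fun E K G => tr L E K G) E K G) (tr L (E.push E.d) K G)
  -- The continuation reaches the jump through the environment; the trailing `K G` are fillers.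
  | _, .mu J, E, K, G => .dot G (tr J (E.kpush K G) K G)
  | _, .jmp k M, E, _, _ => tr M E (E.k k).1 (E.k k).2

/-- The translation of values. -/
def val : {s : Srt} → Exp s → Env → Tm
  | _, .var n, E => E.v n
  | _, .lam M, E => lamVal (fun E K G => tr M E K G) E
  -- A filler: `tr` consults `val` only where `isVal` holds.
  | _, .app _ _, E => E.d
  | _, .lett _ _, E => E.d
  | _, .mu _, E => E.d
  | _, .jmp _ _, E => E.d

end

theorem isVal_iff {M : Term} : isVal M = true ↔ IsValue M := by
  constructor
  · intro h
    cases M with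
    | var n => exact .var n
    | lam M => exact .lam M
    | _ => cases h
  · rintro (_ | _) <;> rfl

theorem tr_of_isVal {s : Srt} {M : Exp s} (h : isVal M = true) (E : Env) (K G : Tm) :
    tr M E K G = .dot G (.app K (val M E)) := by
  cases M with
  | var n => rfl
  | lam M => simp only [tr, val]
  | _ => cases h

/-! ### Substitution in the target -/

theorem frame_subst {t : Den}
    (ht : ∀ σ E K G, (t E K G).subst σ = t (E.subst σ) (K.subst σ) (G.subst σ))
    (σ : ℕ → Tm) (E : Env) (K G : Tm) :
    (frame t E K G).subst σ = frame t (E.subst σ) (K.subst σ) (G.subst σ) := by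
  simp only [frame, Tm.subst, ht, Env.push_subst, Env.up_subst, DotLam.subst_shift]
  rfl

theorem lamVal_subst {t : Den}
    (ht : ∀ σ E K G, (t E K G).subst σ = t (E.subst σ) (K.subst σ) (G.subst σ))
    (σ : ℕ → Tm) (E : Env) : (lamVal t E).subst σ = lamVal t (E.subst σ) := by
  have h : ∀ E : Env, E.up.up.subst (DotLam.Tm.upSubst (DotLam.Tm.upSubst σ)) =
      (E.subst σ).up.up := fun E => by simp only [Env.up_subst]
  have hd : E.up.up.d.subst (DotLam.Tm.upSubst (DotLam.Tm.upSubst σ)) =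
      (E.subst σ).up.up.d := by rw [← h]; rfl
  simp only [lamVal, Tm.subst, ht, frame_subst ht, Env.push_subst, h, hd]
  rfl

theorem appVal_subst {b : Bool} {w : Env → Tm} {u : Den}
    (hw : ∀ σ E, (w E).subst σ = w (E.subst σ))
    (hu : ∀ σ E K G, (u E K G).subst σ = u (E.subst σ) (K.subst σ) (G.subst σ))
    (σ : ℕ → Tm) (v : Tm) (E : Env) (K G : Tm) :
    (appVal b w u v E K G).subst σ =
      appVal b w u (v.subst σ) (E.subst σ) (K.subst σ) (G.subst σ) := by
  cases b <;> simp only [appVal, Tm.subst, hw, hu, DotLam.subst_shift, if_true, if_false,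
    Bool.false_eq_true]
  rfl

theorem tr_val_subst {s : Srt} (e : Exp s) :
    (∀ σ E K G, (tr e E K G).subst σ = tr e (E.subst σ) (K.subst σ) (G.subst σ)) ∧
    (∀ σ E, (val e E).subst σ = val e (E.subst σ)) := by
  induction e with
  | var n => exact ⟨fun σ E K G => by simp only [tr]; rfl, fun σ E => by simp only [val]; rfl⟩
  | lam M ih =>
    refine ⟨fun σ E K G => ?_, fun σ E => ?_⟩
    · simp only [tr, Tm.subst, lamVal_subst ih.1]
    · simp only [val, lamVal_subst ih.1]
  | app M N ih1 ih2 =>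
    refine ⟨fun σ E K G => ?_, fun σ E => by simp only [val]; rfl⟩
    by_cases h : isVal M = true
    · simp only [tr, h, if_true, appVal_subst ih2.2 ih2.1, ih1.2]
    · simp only [tr, h, if_false, Tm.subst, ih1.1, appVal_subst ih2.2 ih2.1, Env.up_subst,
        DotLam.subst_shift, Bool.false_eq_true]
      rfl
  | lett L M ih1 ih2 =>
    refine ⟨fun σ E K G => ?_, fun σ E => by simp only [val]; rfl⟩
    simp only [tr, ih2.1, ih1.1, frame_subst ih1.1, Env.push_subst]
    rfl
  | mu J ih =>
    refine ⟨fun σ E K G => ?_, fun σ E => by simp only [val]; rfl⟩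
    simp only [tr, Tm.subst, ih.1, Env.kpush_subst]
  | jmp k M ih =>
    refine ⟨fun σ E K G => ?_, fun σ E => by simp only [val]; rfl⟩
    simp only [tr, ih.1]
    rfl

theorem tr_subst {s : Srt} (e : Exp s) (σ : ℕ → Tm) (E : Env) (K G : Tm) :
    (tr e E K G).subst σ = tr e (E.subst σ) (K.subst σ) (G.subst σ) :=
  (tr_val_subst e).1 σ E K G

theorem val_subst {s : Srt} (e : Exp s) (σ : ℕ → Tm) (E : Env) :
    (val e E).subst σ = val e (E.subst σ) := (tr_val_subst e).2 σ E

theorem shift_eq_subst (M : Tm) : M.shift = M.subst (fun n => .var (n + 1)) :=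
  DotLam.ren_eq_subst _ _

theorem val_shift {s : Srt} (e : Exp s) (E : Env) : (val e E).shift = val e E.up := by
  rw [shift_eq_subst, val_subst, Env.subst_succ]

theorem frame_shift {s : Srt} (e : Exp s) (E : Env) (K G : Tm) :
    (frame (tr e) E K G).shift = frame (tr e) E.up K.shift G.shift := by
  rw [shift_eq_subst, frame_subst (tr_subst e), Env.subst_succ]
  simp only [shift_eq_subst]

theorem tr_shift {s : Srt} (e : Exp s) (E : Env) (K G : Tm) :
    (tr e E K G).shift = tr e E.up K.shift G.shift := by
  rw [shift_eq_subst, tr_subst, Env.subst_succ]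
  simp only [shift_eq_subst]

theorem tr_push_subst_single {s : Srt} (e : Exp s) (E : Env) (K G V : Tm) :
    (tr e (E.up.push (.var 0)) K.shift G.shift).subst (DotLam.Tm.single V) =
      tr e (E.push V) K G := by
  simp only [tr_subst, Env.push_subst, Env.up_subst_single, DotLam.subst_single_shift]
  rfl

/-! ### Renaming and substitution in the source -/

theorem isVal_ren {s : Srt} (e : Exp s) (ρ θ : ℕ → ℕ) : isVal (e.ren ρ θ) = isVal e := by
  cases e <;> simp only [Exp.ren, isVal]

/-- Formulated as equalities of functions so as to rewrite under the binders of `frame` and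
`lamVal`. -/
theorem tr_val_ren {s : Srt} (e : Exp s) :
    (∀ ρ θ, tr (e.ren ρ θ) = fun E => tr e (E.comp ρ θ)) ∧
    (∀ ρ θ, val (e.ren ρ θ) = fun E => val e (E.comp ρ θ)) := by
  have hlam : ∀ {s : Srt} (e : Exp s), (∀ ρ θ, tr (e.ren ρ θ) = fun E => tr e (E.comp ρ θ)) →
      ∀ (ρ θ : ℕ → ℕ) (E : Env), lamVal (tr (e.ren (up ρ) θ)) E = lamVal (tr e) (E.comp ρ θ) := by
    intro s e ih ρ θ E
    simp only [lamVal, frame, ih, Env.push_comp]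
    rfl
  induction e with
  | var n => exact ⟨fun ρ θ => rfl, fun ρ θ => rfl⟩
  | lam M ih =>
    refine ⟨fun ρ θ => ?_, fun ρ θ => ?_⟩
    · funext E K G
      simp only [tr, Exp.ren]
      rw [hlam M ih.1]
    · funext E
      simp only [val, Exp.ren]
      rw [hlam M ih.1]
  | app M N ih1 ih2 =>
    refine ⟨fun ρ θ => ?_, fun ρ θ => by simp only [val, Exp.ren]; rfl⟩
    funext E K G
    simp only [tr, Exp.ren, isVal_ren, ih1.1, ih2.1, ih1.2, ih2.2]
    rfl
  | lett L M ih1 ih2 =>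
    refine ⟨fun ρ θ => ?_, fun ρ θ => by simp only [val, Exp.ren]; rfl⟩
    funext E K G
    simp only [tr, Exp.ren, ih1.1, ih2.1, frame, Env.push_comp]
    rfl
  | mu J ih =>
    refine ⟨fun ρ θ => ?_, fun ρ θ => by simp only [val, Exp.ren]; rfl⟩
    funext E K G
    simp only [tr, Exp.ren, ih.1, Env.kpush_comp]
  | jmp k M ih =>
    refine ⟨fun ρ θ => ?_, fun ρ θ => by simp only [val, Exp.ren]; rfl⟩
    funext E K G
    simp only [tr, Exp.ren, ih.1]
    rfl

theorem tr_ren {s : Srt} (e : Exp s) (ρ θ : ℕ → ℕ) (E : Env) :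
    tr (e.ren ρ θ) E = tr e (E.comp ρ θ) := congrFun ((tr_val_ren e).1 ρ θ) E

theorem val_ren {s : Srt} (e : Exp s) (ρ θ : ℕ → ℕ) (E : Env) :
    val (e.ren ρ θ) E = val e (E.comp ρ θ) := congrFun ((tr_val_ren e).2 ρ θ) E

theorem tr_shift_push {s : Srt} (e : Exp s) (E : Env) (V : Tm) :
    tr e.shift (E.push V) = tr e E := tr_ren _ _ _ _

theorem val_shift_push {s : Srt} (e : Exp s) (E : Env) (V : Tm) :
    val e.shift (E.push V) = val e E := val_ren _ _ _ _

theorem tr_cshift_kpush {s : Srt} (e : Exp s) (E : Env) (K G : Tm) :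
    tr e.cshift (E.kpush K G) = tr e E := tr_ren _ _ _ _

theorem val_cshift_kpush {s : Srt} (e : Exp s) (E : Env) (K G : Tm) :
    val e.cshift (E.kpush K G) = val e E := val_ren _ _ _ _

/-- The environment in which the meaning of a substituted expression is computed. -/
def Env.withSubst (E : Env) (τ : ℕ → Term) : Env := ⟨E.d, fun n => val (τ n) E, E.k⟩

theorem Env.withSubst_up (E : Env) (τ : ℕ → Term) : (E.withSubst τ).up = E.up.withSubst τ := by
  simp only [Env.withSubst, Env.up, val_shift]

theorem Env.withSubst_push (E : Env) (τ : ℕ → Term) (V : Tm) :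
    (E.push V).withSubst (Exp.upSubst τ) = (E.withSubst τ).push V := by
  simp only [Env.withSubst, Env.push, Env.mk.injEq, true_and, and_true]
  funext n
  cases n with
  | zero => rfl
  | succ n => exact val_shift_push _ _ _

theorem Env.withSubst_kpush (E : Env) (τ : ℕ → Term) (K G : Tm) :
    (E.kpush K G).withSubst (fun n => (τ n).cshift) = (E.withSubst τ).kpush K G := by
  simp only [Env.withSubst, Env.kpush, Env.mk.injEq, true_and, and_true]
  funext n
  exact val_cshift_kpush _ _ _ _

theorem isVal_subst {s : Srt} (e : Exp s) {τ : ℕ → Term} (hτ : ∀ n, isVal (τ n) = true) :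
    isVal (e.subst τ) = isVal e := by
  cases e with
  | var n => exact hτ n
  | _ => simp only [Exp.subst, isVal]

theorem isVal_upSubst {τ : ℕ → Term} (hτ : ∀ n, isVal (τ n) = true) (n : ℕ) :
    isVal (Exp.upSubst τ n) = true := by
  cases n with
  | zero => rfl
  | succ n => exact (isVal_ren _ _ _).trans (hτ n)

/-- Substituted terms must be values: the translation looks up a target value for each variable, and
the case distinction made by `isVal` must be preserved. -/
theorem tr_val_substitution {s : Srt} (e : Exp s) :
    (∀ τ, (∀ n, isVal (τ n) = true) → tr (e.subst τ) = fun E => tr e (E.withSubst τ)) ∧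
    (∀ τ, (∀ n, isVal (τ n) = true) → val (e.subst τ) = fun E => val e (E.withSubst τ)) := by
  have hlam : ∀ {s : Srt} (e : Exp s),
      (∀ τ, (∀ n, isVal (τ n) = true) → tr (e.subst τ) = fun E => tr e (E.withSubst τ)) →
      ∀ (τ : ℕ → Term), (∀ n, isVal (τ n) = true) → ∀ (E : Env),
        lamVal (tr (e.subst (Exp.upSubst τ))) E = lamVal (tr e) (E.withSubst τ) := by
    intro s e ih τ hτ E
    simp only [lamVal, frame, ih _ (isVal_upSubst hτ), Env.withSubst_push, Env.withSubst_up]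
    rfl
  induction e with
  | var n =>
    refine ⟨fun τ hτ => ?_, fun τ hτ => ?_⟩
    · funext E K G
      simp only [tr, Exp.subst, tr_of_isVal (hτ n)]
      rfl
    · funext E
      simp only [val, Exp.subst]
      rfl
  | lam M ih =>
    refine ⟨fun τ hτ => ?_, fun τ hτ => ?_⟩
    · funext E K G
      simp only [tr, Exp.subst]
      rw [hlam M ih.1 τ hτ]
    · funext E
      simp only [val, Exp.subst]
      rw [hlam M ih.1 τ hτ]
  | app M N ih1 ih2 =>
    refine ⟨fun τ hτ => ?_, fun τ hτ => by simp only [val, Exp.subst]; rfl⟩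
    funext E K G
    simp only [tr, Exp.subst, isVal_subst _ hτ, ih1.1 τ hτ, ih2.1 τ hτ, ih1.2 τ hτ,
      ih2.2 τ hτ, appVal, Env.withSubst_up]
    rfl
  | lett L M ih1 ih2 =>
    refine ⟨fun τ hτ => ?_, fun τ hτ => by simp only [val, Exp.subst]; rfl⟩
    funext E K G
    simp only [tr, Exp.subst, ih1.1 _ (isVal_upSubst hτ), ih2.1 τ hτ, frame,
      Env.withSubst_push, Env.withSubst_up]
    rfl
  | mu J ih =>
    refine ⟨fun τ hτ => ?_, fun τ hτ => by simp only [val, Exp.subst]; rfl⟩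
    funext E K G
    simp only [tr, Exp.subst]
    rw [ih.1 (fun n => (τ n).cshift) fun n => (isVal_ren _ _ _).trans (hτ n)]
    simp only [Env.withSubst_kpush]
  | jmp k M ih =>
    refine ⟨fun τ hτ => ?_, fun τ hτ => by simp only [val, Exp.subst]; rfl⟩
    funext E K G
    simp only [tr, Exp.subst, ih.1 τ hτ]
    rfl

theorem tr_inst {s : Srt} (e : Exp s) {V : Term} (hV : isVal V = true) (E : Env) :
    tr (e.inst V) E = tr e (E.push (val V E)) := by
  have h : ∀ n, isVal (Exp.single V n) = true := fun n => by cases n <;> [exact hV; rfl]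
  have h' : E.withSubst (Exp.single V) = E.push (val V E) := by
    simp only [Env.withSubst, Env.push, Env.mk.injEq, true_and, and_true]
    funext n
    cases n with
    | zero => rfl
    | succ n => simp only [Exp.single, val]
  rw [Exp.inst, (tr_val_substitution e).1 _ h]
  exact congrArg (tr e) h'

/-- The environment with the continuation variable `k` prefixed by the frame of `M`. -/
def Env.prefixed (E : Env) (k : ℕ) (M : Term) : Env :=
  ⟨E.d, E.v, fun n => if n = k then
    (frame (tr M) E (E.k k).1 (E.k k).2, tr M (E.push E.d) (E.k k).1 (E.k k).2) else E.k n⟩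

theorem Env.prefixed_up (E : Env) (k : ℕ) (M : Term) :
    (E.prefixed k M).up = E.up.prefixed k M := by
  simp only [Env.prefixed, Env.up, Env.mk.injEq, true_and]
  funext n
  by_cases h : n = k
  · simp only [h, if_true, frame_shift, tr_shift, Env.push_up]
    rfl
  · simp only [h, if_false]

theorem Env.prefixed_push (E : Env) (k : ℕ) (M : Term) (V : Tm) :
    (E.push V).prefixed k (M.ren (CCV.up Nat.succ) id) = (E.prefixed k M).push V := by
  simp only [Env.prefixed, frame, tr_ren, Env.push_comp, Env.push_up]
  rfl

theorem Env.prefixed_kpush (E : Env) (k : ℕ) (M : Term) (K G : Tm) :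
    (E.kpush K G).prefixed (k + 1) M.cshift = (E.prefixed k M).kpush K G := by
  simp only [Env.prefixed, Env.kpush, Env.mk.injEq, true_and]
  funext n
  cases n with
  | zero => rfl
  | succ n =>
    have h1 : ∀ V, tr M.cshift ((E.kpush K G).push V) = tr M (E.push V) :=
      fun V => tr_cshift_kpush M (E.push V) K G
    have h2 : ∀ V, tr M.cshift ((E.kpush K G).up.push V) = tr M (E.up.push V) := fun V => by
      rw [Env.kpush_up]; exact tr_cshift_kpush M (E.up.push V) _ _
    simp only [Nat.add_right_cancel_iff]
    by_cases h : n = k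
    · simp only [h, if_true, frame]
      exact Prod.ext (congrArg Tm.lam (congrFun (congrFun (h2 _) _) _))
        (congrFun (congrFun (h1 _) _) _)
    · simp only [h, if_false]

theorem isVal_csubst {s : Srt} (e : Exp s) (k : ℕ) (M : Term) :
    isVal (Exp.csubst k M e) = isVal e := by
  cases e with
  | jmp j N => by_cases h : j = k <;> simp only [Exp.csubst, h, if_true, if_false, isVal]
  | _ => simp only [Exp.csubst, isVal]

/-- Only jumpers consult the continuations of the environment, and a let around the jumped term
prefixes its frame to the continuation. So the context substitution is a change of environment. -/
theorem tr_val_csubst {s : Srt} (e : Exp s) :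
    (∀ k M, tr (Exp.csubst k M e) = fun E => tr e (E.prefixed k M)) ∧
    (∀ k M, val (Exp.csubst k M e) = fun E => val e (E.prefixed k M)) := by
  have hlam : ∀ {s : Srt} (e : Exp s),
      (∀ k M, tr (Exp.csubst k M e) = fun E => tr e (E.prefixed k M)) →
      ∀ (k : ℕ) (M : Term) (E : Env),
        lamVal (tr (Exp.csubst k (M.ren (up Nat.succ) id) e)) E = lamVal (tr e) (E.prefixed k M) := by
    intro s e ih k M E
    simp only [lamVal, frame, ih, Env.prefixed_push, Env.prefixed_up]
    rfl
  induction e with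
  | var n => exact ⟨fun k M => by simp only [Exp.csubst]; rfl, fun k M => by
      simp only [Exp.csubst]; rfl⟩
  | lam N ih =>
    refine ⟨fun k M => ?_, fun k M => ?_⟩
    · funext E K G
      simp only [tr, Exp.csubst]
      rw [hlam N ih.1]
    · funext E
      simp only [val, Exp.csubst]
      rw [hlam N ih.1]
  | app N P ih1 ih2 =>
    refine ⟨fun k M => ?_, fun k M => by simp only [val, Exp.csubst]; rfl⟩
    funext E K G
    simp only [tr, Exp.csubst, isVal_csubst, ih1.1, ih2.1, ih1.2, ih2.2, appVal,
      Env.prefixed_up]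
    rfl
  | lett L N ih1 ih2 =>
    refine ⟨fun k M => ?_, fun k M => by simp only [val, Exp.csubst]; rfl⟩
    funext E K G
    simp only [tr, Exp.csubst, ih1.1, ih2.1, frame, Env.prefixed_push, Env.prefixed_up]
    rfl
  | mu J ih =>
    refine ⟨fun k M => ?_, fun k M => by simp only [val, Exp.csubst]; rfl⟩
    funext E K G
    simp only [tr, Exp.csubst, ih.1, Env.prefixed_kpush]
  | jmp j N ih =>
    refine ⟨fun k M => ?_, fun k M => ?_⟩
    · funext E K G
      by_cases h : j = k
      · simp only [tr, Exp.csubst, h, if_true, ih.1, Env.prefixed]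
      · simp only [tr, Exp.csubst, h, if_false, ih.1, Env.prefixed]
    · by_cases h : j = k <;> simp only [Exp.csubst, h, if_true, if_false, val] <;> rfl

/-! ### Invariance under syntactic equality -/

/-- Lets hand the pair on to the jump in their body, and a jumper replaces it by one from the
environment. -/
theorem tr_jump {s : Srt} (e : Exp s) (hs : s = Srt.jump) (E : Env) (K G K' G' : Tm) :
    tr e E K G = tr e E K' G' := by
  induction e generalizing E K G K' G' with
  | lett L M ih1 _ =>
    have := ih1 hs
    simp only [tr, frame]
    rw [this (E.up.push (.var 0)) K.shift G.shift K'.shift G'.shift,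
      this (E.push E.d) K G K' G']
  | jmp k M _ => simp only [tr]
  | _ => cases hs

/-- Both sides compose the same frames and guards in the same order. -/
theorem AssocAx.tr_eq {s : Srt} {e e' : Exp s} (h : AssocAx s e e') : tr e = tr e' := by
  cases h with
  | lett L M N =>
    funext E K G
    simp only [tr, frame, tr_ren, Env.push_comp, Env.push_up]
    have h1 := frame_shift L E K G
    have h2 := tr_shift L (E.push E.d) K G
    simp only [frame, Env.push_up] at h1 h2
    rw [h1, h2]
    rfl
  | jmp k L M =>
    funext E K G
    simp only [tr, frame]
    rfl

theorem tr_eq_of_compat {s : Srt} {e e' : Exp s} (h : Compat AssocAx s e e') :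
    tr e = tr e' ∧ val e = val e' ∧ isVal e = isVal e' := by
  induction h with
  | root h => exact ⟨h.tr_eq, by cases h <;> rfl, by cases h <;> rfl⟩
  | lam _ ih =>
    refine ⟨?_, ?_, rfl⟩
    · funext E K G; simp only [tr, ih.1]
    · funext E; simp only [val, ih.1]
  | appL _ ih => exact ⟨by funext E K G; simp only [tr, ih.1, ih.2.1, ih.2.2], rfl, rfl⟩
  | appR _ ih => exact ⟨by funext E K G; simp only [tr, ih.1, ih.2.1, ih.2.2], rfl, rfl⟩
  | lettL _ ih => exact ⟨by funext E K G; simp only [tr, ih.1], rfl, rfl⟩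
  | lettR _ ih => exact ⟨by funext E K G; simp only [tr, ih.1], rfl, rfl⟩
  | mu _ ih => exact ⟨by funext E K G; simp only [tr, ih.1], rfl, rfl⟩
  | jmp _ ih => exact ⟨by funext E K G; simp only [tr, ih.1], rfl, rfl⟩

theorem Same.tr_eq {s : Srt} {e e' : Exp s} (h : Same s e e') :
    tr e = tr e' ∧ val e = val e' ∧ isVal e = isVal e' := by
  induction h with
  | rel e e' h => exact tr_eq_of_compat h
  | refl => exact ⟨rfl, rfl, rfl⟩
  | symm _ _ _ ih => exact ⟨ih.1.symm, ih.2.1.symm, ih.2.2.symm⟩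
  | trans _ _ _ _ _ ih1 ih2 =>
    exact ⟨ih1.1.trans ih2.1, ih1.2.1.trans ih2.2.1, ih1.2.2.trans ih2.2.2⟩

end CCV

-- CCV: each reduction step is simulated by at least one dot step

namespace CCV

open DotLam (Tm Red Reds Redp SN)
open Relation

/-! ### Monotonicity of the translation -/

/-- An environment of pairwise distinct variables, which leaves out `1` and `2`. -/
def Env.generic : Env :=
  ⟨.var 0, fun n => .var (3 * n + 3), fun n => (.var (3 * n + 4), .var (3 * n + 5))⟩

/-- The substitution which turns the generic environment into a given one. -/
def Env.specialize (E : Env) (K G : Tm) : ℕ → Tm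
  | 0 => E.d
  | 1 => K
  | 2 => G
  | n + 3 => if n % 3 = 0 then E.v (n / 3) else
      if n % 3 = 1 then (E.k (n / 3)).1 else (E.k (n / 3)).2

/-- Turns all parameters of the translation into free variables, so that monotonicity in each of
them follows from `Reds.subst_right`. -/
theorem tr_eq_subst_generic {s : Srt} (e : Exp s) (E : Env) (K G : Tm) :
    tr e E K G = (tr e Env.generic (.var 1) (.var 2)).subst (E.specialize K G) := by
  have h : Env.generic.subst (E.specialize K G) = E := by
    obtain ⟨d, v, k⟩ := E
    simp only [Env.subst, Env.generic, Tm.subst, Env.specialize, Env.mk.injEq, true_and]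
    refine ⟨?_, ?_⟩
    · funext n
      simp
    · funext n
      have h1 : (3 * n + 1) % 3 = 1 := by omega
      have h2 : (3 * n + 1) / 3 = n := by omega
      have h3 : (3 * n + 2) % 3 = 2 := by omega
      have h4 : (3 * n + 2) / 3 = n := by omega
      simp [h1, h2, h3, h4]
  rw [tr_subst, h]
  rfl

theorem tr_reds {s : Srt} (e : Exp s) {E E' : Env} {K K' G G' : Tm} (hd : Reds E.d E'.d)
    (hv : ∀ n, Reds (E.v n) (E'.v n))
    (hk : ∀ n, Reds (E.k n).1 (E'.k n).1 ∧ Reds (E.k n).2 (E'.k n).2)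
    (hK : Reds K K') (hG : Reds G G') : Reds (tr e E K G) (tr e E' K' G') := by
  rw [tr_eq_subst_generic e E, tr_eq_subst_generic e E']
  refine Reds.subst_right (fun n => ?_) _
  match n with
  | 0 => exact hd
  | 1 => exact hK
  | 2 => exact hG
  | n + 3 =>
    simp only [Env.specialize]
    split_ifs
    · exact hv _
    · exact (hk _).1
    · exact (hk _).2

theorem tr_reds_cont {s : Srt} (e : Exp s) (E : Env) {K K' G G' : Tm}
    (hK : Reds K K') (hG : Reds G G') : Reds (tr e E K G) (tr e E K' G') :=
  tr_reds e .refl (fun _ => .refl) (fun _ => ⟨.refl, .refl⟩) hK hG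

theorem tr_reds_kpush {s : Srt} (e : Exp s) (E : Env) {K K' G G' : Tm}
    (hK : Reds K K') (hG : Reds G G') :
    Reds (tr e (E.kpush K G) K G) (tr e (E.kpush K' G') K' G') :=
  tr_reds e .refl (fun _ => .refl)
    (fun n => by cases n <;> [exact ⟨hK, hG⟩; exact ⟨.refl, .refl⟩]) hK hG

theorem frame_reds {s : Srt} (e : Exp s) (E : Env) {K K' G G' : Tm}
    (hK : Reds K K') (hG : Reds G G') : Reds (frame (tr e) E K G) (frame (tr e) E K' G') :=
  Reds.lam (tr_reds_cont e _ hK.shift hG.shift)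

/-- The meaning of the application of a value `v` to a term `N`. -/
abbrev appTr (N : Term) : Tm → Den := appVal (isVal N) (val N) (tr N)

theorem appTr_of_isVal {N : Term} (h : isVal N = true) (v : Tm) (E : Env) (K G : Tm) :
    appTr N v E K G = .dot G (.app (.app v K) (val N E)) := by
  simp only [appTr, appVal, h, if_true]

theorem appTr_of_not_isVal {N : Term} (h : ¬ isVal N = true) (v : Tm) (E : Env) (K G : Tm) :
    appTr N v E K G = .dot G (tr N E
      (.lam (.dot G.shift (.app (.app v.shift K.shift) (.var 0))))
      (.dot G (.app (.app v K) E.d))) := by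
  simp only [appTr, appVal, h, if_false, Bool.false_eq_true]

theorem tr_app_of_isVal {M : Term} (h : isVal M = true) (N : Term) (E : Env) (K G : Tm) :
    tr (.app M N) E K G = appTr N (val M E) E K G := by
  simp only [tr, h, if_true]

theorem tr_app_of_not_isVal {M : Term} (h : ¬ isVal M = true) (N : Term) (E : Env) (K G : Tm) :
    tr (.app M N) E K G = .dot G (tr M E (.lam (appTr N (.var 0) E.up K.shift G.shift))
      (appTr N E.d E K G)) := by
  simp only [tr, h, if_false, Bool.false_eq_true]

theorem appTr_body_reds (N : Term) (E : Env) {v v' K K' G G' : Tm}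
    (hv : Reds v v') (hK : Reds K K') (hG : Reds G G') :
    Reds (tr N E (.lam (.dot G.shift (.app (.app v.shift K.shift) (.var 0))))
        (.dot G (.app (.app v K) E.d)))
      (tr N E (.lam (.dot G'.shift (.app (.app v'.shift K'.shift) (.var 0))))
        (.dot G' (.app (.app v' K') E.d))) :=
  tr_reds_cont N E
    (Reds.lam (Reds.dot hG.shift (Reds.app (Reds.app hv.shift hK.shift) .refl)))
    (Reds.dot hG (Reds.app (Reds.app hv hK) .refl))

theorem appTr_reds (N : Term) (E : Env) {v v' K K' G G' : Tm}
    (hv : Reds v v') (hK : Reds K K') (hG : Reds G G') :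
    Reds (appTr N v E K G) (appTr N v' E K' G') := by
  by_cases h : isVal N = true
  · rw [appTr_of_isVal h, appTr_of_isVal h]
    exact Reds.dot hG (Reds.app (Reds.app hv hK) .refl)
  · rw [appTr_of_not_isVal h, appTr_of_not_isVal h]
    exact Reds.dot hG (appTr_body_reds N E hv hK hG)

theorem appTr_redp (N : Term) (E : Env) (v : Tm) {K K' G G' : Tm}
    (hK : Reds K K') (hG : Redp G G') : Redp (appTr N v E K G) (appTr N v E K' G') := by
  by_cases h : isVal N = true
  · rw [appTr_of_isVal h, appTr_of_isVal h]
    exact Redp.dotL hG (Reds.app (Reds.app .refl hK) .refl)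
  · rw [appTr_of_not_isVal h, appTr_of_not_isVal h]
    exact Redp.dotL hG (appTr_body_reds N E .refl hK hG.to_reflTransGen)

theorem appTr_subst_single (N : Term) (E : Env) (K G V : Tm) :
    (appTr N (.var 0) E.up K.shift G.shift).subst (DotLam.Tm.single V) = appTr N V E K G := by
  rw [appTr, appVal_subst (val_subst N) (tr_subst N), Env.up_subst_single,
    DotLam.subst_single_shift, DotLam.subst_single_shift]
  rfl

theorem appFrame_reds (N : Term) (E : Env) {K K' G G' : Tm} (hK : Reds K K') (hG : Reds G G') :
    Reds (.lam (appTr N (.var 0) E.up K.shift G.shift))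
      (.lam (appTr N (.var 0) E.up K'.shift G'.shift)) :=
  Reds.lam (appTr_reds N _ .refl hK.shift hG.shift)

/-- The second component of a continuation is never erased. -/
theorem tr_redp_cont {s : Srt} (e : Exp s) (hs : s = Srt.term) (E : Env) {K K' G G' : Tm}
    (hK : Reds K K') (hG : Redp G G') : Redp (tr e E K G) (tr e E K' G') := by
  induction e generalizing E K K' G G' with
  | var n => exact Redp.dotL hG (Reds.app hK .refl)
  | lam M _ =>
    simp only [tr]
    exact Redp.dotL hG (Reds.app hK .refl)
  | app M N _ _ =>
    by_cases h : isVal M = true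
    · rw [tr_app_of_isVal h, tr_app_of_isVal h]
      exact appTr_redp N E _ hK hG
    · rw [tr_app_of_not_isVal h, tr_app_of_not_isVal h]
      exact Redp.dotL hG (tr_reds_cont M E (appFrame_reds N E hK hG.to_reflTransGen)
        (appTr_reds N E .refl hK hG.to_reflTransGen))
  | lett L M ih1 ih2 =>
    simp only [tr]
    -- The guard passed to `M` is the translated body, which itself keeps `G`; strictness passes
    -- through both.
    exact ih2 rfl E (frame_reds L E hK hG.to_reflTransGen) (ih1 hs _ hK hG)
  | mu J _ =>
    simp only [tr]
    exact Redp.dotL hG (tr_reds_kpush J E hK hG.to_reflTransGen)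
  | jmp k M _ => cases hs

/-- The second component of a continuation can be brought to the front. -/
theorem exists_tr_reds_dot {s : Srt} (e : Exp s) (hs : s = Srt.term) (E : Env) (K G : Tm) :
    ∃ Q, Reds (tr e E K G) (.dot G Q) := by
  induction e generalizing E K G with
  | var n => exact ⟨_, .refl⟩
  | lam M _ =>
    simp only [tr]
    exact ⟨_, .refl⟩
  | app M N _ _ =>
    by_cases h : isVal M = true
    · rw [tr_app_of_isVal h]
      by_cases h' : isVal N = true
      · rw [appTr_of_isVal h']; exact ⟨_, .refl⟩
      · rw [appTr_of_not_isVal h']; exact ⟨_, .refl⟩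
    · rw [tr_app_of_not_isVal h]; exact ⟨_, .refl⟩
  | lett L M ih1 ih2 =>
    simp only [tr]
    obtain ⟨Q, hQ⟩ := ih1 hs (E.push E.d) K G
    obtain ⟨Q', hQ'⟩ := ih2 rfl E (frame (tr L) E K G) (tr L (E.push E.d) K G)
    exact ⟨_, (hQ'.trans (Reds.dot hQ .refl)).tail (.assoc _ _ _)⟩
  | mu J _ =>
    simp only [tr]
    exact ⟨_, .refl⟩
  | jmp k M _ => cases hs

theorem redp_dot_assoc {X G P P' : Tm} (h : Reds P P') :
    Redp (.dot (.dot X G) P) (.dot X (.dot G P')) :=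
  TransGen.head' (.assoc _ _ _) (Reds.dot .refl (Reds.dot .refl h))

theorem reds_drop (X G : Tm) : Reds (.dot X G) G := .single (.drop X G)

/-- Needed for `exch`, where the guard emitted by the μ must move in front of the whole let.
Reassociating at the front provides a strict step; surplus copies of `X` are dropped. -/
theorem tr_redp_pull {s : Srt} (e : Exp s) (hs : s = Srt.term) (E : Env) (K X G : Tm) :
    Redp (tr e E K (.dot X G)) (.dot X (tr e E K G)) := by
  induction e generalizing E K X G with
  | var n => exact redp_dot_assoc .refl
  | lam M _ =>
    simp only [tr]
    exact redp_dot_assoc .refl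
  | app M N _ _ =>
    by_cases h : isVal M = true
    · rw [tr_app_of_isVal h, tr_app_of_isVal h]
      by_cases h' : isVal N = true
      · rw [appTr_of_isVal h', appTr_of_isVal h']
        exact redp_dot_assoc .refl
      · rw [appTr_of_not_isVal h', appTr_of_not_isVal h']
        exact redp_dot_assoc (appTr_body_reds N E .refl .refl (reds_drop X G))
    · rw [tr_app_of_not_isVal h, tr_app_of_not_isVal h]
      exact redp_dot_assoc (tr_reds_cont M E (appFrame_reds N E .refl (reds_drop X G))
        (appTr_reds N E .refl .refl (reds_drop X G)))
  | lett L M ih1 ih2 =>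
    simp only [tr]
    exact TransGen.trans_right (tr_reds_cont M E (frame_reds L E .refl (reds_drop X G))
      (ih1 hs (E.push E.d) K X G).to_reflTransGen) (ih2 rfl E _ X _)
  | mu J _ =>
    simp only [tr]
    exact redp_dot_assoc (tr_reds_kpush J E .refl (reds_drop X G))
  | jmp k M _ => cases hs

/-! ### Simulation of the reduction rules -/

/-- The second component of a continuation is obtained from the first one. -/
def GoodCont (d K G : Tm) : Prop := Reds (.app K d) G

/-- All continuations of the environment are good. -/
def Env.Good (E : Env) : Prop := ∀ n, GoodCont E.d (E.k n).1 (E.k n).2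

theorem GoodCont.shift {d K G : Tm} (h : GoodCont d K G) : GoodCont d.shift K.shift G.shift :=
  Reds.shift h

theorem Env.Good.up {E : Env} (h : E.Good) : E.up.Good := fun n => (h n).shift

theorem Env.Good.push {E : Env} (h : E.Good) (V : Tm) : (E.push V).Good := h

theorem Env.Good.kpush {E : Env} (h : E.Good) {K G : Tm} (hK : GoodCont E.d K G) :
    (E.kpush K G).Good := fun n => by cases n <;> [exact hK; exact h _]

/-- Feeding the dummy to the frame is one β-step; this maintains goodness on entering the argument
of a let. -/
theorem goodCont_frame {s : Srt} (e : Exp s) (E : Env) (K G : Tm) :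
    GoodCont E.d (frame (tr e) E K G) (tr e (E.push E.d) K G) := by
  have := Red.beta (tr e (E.up.push (.var 0)) K.shift G.shift) E.d
  rw [tr_push_subst_single] at this
  exact .single this

theorem goodCont_appFrame (N : Term) (E : Env) (K G : Tm) :
    GoodCont E.d (.lam (appTr N (.var 0) E.up K.shift G.shift)) (appTr N E.d E K G) := by
  have := Red.beta (appTr N (.var 0) E.up K.shift G.shift) E.d
  rw [appTr_subst_single] at this
  exact .single this

theorem goodCont_argFrame (d v K G : Tm) :
    GoodCont d (.lam (.dot G.shift (.app (.app v.shift K.shift) (.var 0))))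
      (.dot G (.app (.app v K) d)) := by
  have := Red.beta (.dot G.shift (.app (.app v.shift K.shift) (.var 0))) d
  simp only [Tm.subst, DotLam.subst_single_shift] at this
  exact .single this

theorem lamVal_body_subst {s : Srt} (e : Exp s) (E : Env) (K V : Tm) :
    ((Tm.dot (tr e (E.up.up.push E.up.up.d) (.var 1) (.app (.var 1) E.up.up.d))
      (.app (frame (tr e) E.up.up (.var 1) (.app (.var 1) E.up.up.d)) (.var 0))).subst
        (DotLam.Tm.upSubst (DotLam.Tm.single K))).subst (DotLam.Tm.single V) =
      .dot (tr e (E.push E.d) K (.app K E.d)) (.app (frame (tr e) E K (.app K E.d)) V) := by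
  have h1 : E.up.up.subst (DotLam.Tm.upSubst (DotLam.Tm.single K)) = E.up := by
    rw [Env.up_subst, Env.up_subst_single]
  have hd : E.up.up.d.subst (DotLam.Tm.upSubst (DotLam.Tm.single K)) = E.up.d :=
    congrArg Env.d h1
  have hd' : E.up.d.subst (DotLam.Tm.single V) = E.d := DotLam.subst_single_shift _ _
  simp only [Tm.subst, tr_subst, frame_subst (tr_subst e), Env.push_subst, h1, hd,
    Env.up_subst_single, hd', DotLam.Tm.upSubst, DotLam.Tm.single, DotLam.subst_single_shift]

theorem reds_app_lamVal {s : Srt} (e : Exp s) (E : Env) (K V : Tm) :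
    Reds (.app (.app (lamVal (tr e) E) K) V)
      (.dot (tr e (E.push E.d) K (.app K E.d)) (.app (frame (tr e) E K (.app K E.d)) V)) := by
  rw [← lamVal_body_subst]
  exact .head (.appL (Red.beta _ K)) (.single (Red.beta _ V))

theorem tr_lett {s : Srt} (L : Exp s) (M : Term) (E : Env) (K G : Tm) :
    tr (.lett L M) E K G = tr M E (frame (tr L) E K G) (tr L (E.push E.d) K G) := by
  simp only [tr]

theorem tr_app_var_shift (M : Term) (E : Env) (V K G : Tm) :
    tr (.app (.var 0) M.shift) (E.push V) K G = appTr M V E K G := by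
  have h : isVal M.shift = isVal M := isVal_ren _ _ _
  rw [tr_app_of_isVal rfl]
  simp only [appTr, appVal, h, tr_shift_push, val_shift_push, val]
  rfl

theorem tr_app_shift_var {V : Term} (hV : isVal V = true) (E : Env) (W K G : Tm) :
    tr (.app V.shift (.var 0)) (E.push W) K G = .dot G (.app (.app (val V E) K) W) := by
  have h : isVal V.shift = true := (isVal_ren _ _ _).trans hV
  rw [tr_app_of_isVal h, appTr_of_isVal rfl, val_shift_push]
  simp only [val]
  rfl

/-- Dropping the guards leaves `λk. λx. (λy. V k y) x`, which three η-steps contract to `V`. -/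
theorem redp_lamVal_app_shift_var {V : Term} (hV : isVal V = true) (E : Env) :
    Redp (lamVal (tr (.app V.shift (.var 0))) E) (val V E) := by
  simp only [lamVal, frame, tr_app_shift_var hV, ← val_shift]
  refine .head (.lam (.lam (Red.drop _ _)))
    (.head (.lam (.lam (.appL (.lam (Red.drop _ _))))) ?_)
  exact .head (.lam (.lam (.appL (Red.eta (.app (val V E).shift.shift (.var 1))))))
    (.head (.lam (Red.eta (.app (val V E).shift (.var 0)))) (.single (Red.eta (val V E))))

/-- Goodness of the continuation serves `betaLam` and `etaLet`, whose left sides yield `K` applied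
to the dummy where the right sides have `G`. -/
theorem redp_rule {s : Srt} {e e' : Exp s} (h : Rule s e e') {E : Env} {K G : Tm}
    (hK : GoodCont E.d K G) : Redp (tr e E K G) (tr e' E K G) := by
  cases h with
  | ad1 N M hN =>
    rw [← isVal_iff] at hN
    rw [tr_app_of_not_isVal hN, tr_lett]
    simp only [frame, tr_app_var_shift]
    exact .single (Red.drop _ _)
  | ad2 V N hV hN =>
    rw [← isVal_iff] at hN hV
    rw [tr_app_of_isVal hV, appTr_of_not_isVal hN, tr_lett]
    simp only [frame, tr_app_shift_var hV, ← val_shift]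
    exact .single (Red.drop _ _)
  | betaLam M V hV =>
    rw [← isVal_iff] at hV
    rw [tr_app_of_isVal rfl, appTr_of_isVal hV]
    simp only [tr, tr_of_isVal hV, val]
    exact TransGen.head' (.drop _ _) ((reds_app_lamVal M E K _).trans
      (Reds.dot (tr_reds_cont M _ .refl hK) (Reds.app (frame_reds M E .refl hK) .refl)))
  | betaLet M V hV =>
    rw [← isVal_iff] at hV
    simp only [tr, tr_of_isVal hV]
    have := Red.beta (tr M (E.up.push (.var 0)) K.shift G.shift) (val V E)
    rw [tr_push_subst_single, ← tr_inst M hV] at this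
    exact .head (Red.drop _ _) (.single this)
  | betaMu M J =>
    simp only [tr]
    have h : (E.kpush K G).prefixed 0 M.cshift =
        E.kpush (frame (tr M) E K G) (tr M (E.push E.d) K G) := by
      have h1 : ∀ V, tr M.cshift ((E.kpush K G).push V) = tr M (E.push V) :=
        fun V => tr_cshift_kpush M (E.push V) K G
      have h2 : ∀ V, tr M.cshift ((E.kpush K G).up.push V) = tr M (E.up.push V) := fun V => by
        rw [Env.kpush_up]; exact tr_cshift_kpush M (E.up.push V) _ _
      simp only [Env.prefixed, Env.kpush, Env.mk.injEq, true_and]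
      funext n
      cases n with
      | zero =>
        simp only [if_true, frame]
        exact Prod.ext (congrArg Tm.lam (congrFun (congrFun (h2 _) _) _))
          (congrFun (congrFun (h1 _) _) _)
      | succ n => rfl
    rw [congrFun ((tr_val_csubst J).1 0 M.cshift) (E.kpush K G), h,
      tr_jump J rfl _ K G (frame (tr M) E K G) (tr M (E.push E.d) K G)]
    -- The left guard, `M` at the dummy, is brought to the form `G · Q`; reassociating and dropping
    -- `Q` leaves the guard `G` of the right side.
    obtain ⟨Q, hQ⟩ := exists_tr_reds_dot M rfl (E.push E.d) K G
    exact TransGen.trans_right (Reds.dot hQ .refl)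
      (.head (Red.assoc _ _ _) (.single (.dotR (Red.drop _ _))))
  | betaJmp l J =>
    simp only [tr, Exp.cinst, tr_ren]
    have h : E.comp id (Exp.csingle l) = E.kpush (E.k l).1 (E.k l).2 := by
      simp only [Env.comp, Env.kpush, Env.mk.injEq, true_and]
      exact ⟨rfl, by funext n; cases n <;> rfl⟩
    rw [h, tr_jump J rfl _ K G (E.k l).1 (E.k l).2]
    exact .single (.drop _ _)
  | etaLam V hV =>
    rw [← isVal_iff] at hV
    rw [tr_of_isVal hV]
    simp only [tr]
    exact Redp.dotR .refl (Redp.appR .refl (redp_lamVal_app_shift_var hV E))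
  | etaLet M =>
    simp only [tr]
    refine tr_redp_cont _ rfl E ?_ (TransGen.head' (.drop _ _) hK)
    exact .head (.lam (Red.drop _ _)) (.single (Red.eta K))
  | etaMu M =>
    simp only [tr]
    rw [tr_cshift_kpush]
    exact .single (Red.drop _ _)
  | exch J M =>
    simp only [tr]
    -- The guard `G` emitted by the μ is pulled out of the guard of the let; its other copy, inside
    -- the frame, is dropped at the end.
    have h1 := tr_redp_pull M rfl E (frame (tr J.mu) E K G) G
      (tr J ((E.push E.d).kpush K G) K G)
    have h2 : tr M.cshift (E.kpush K G) = tr M E := tr_cshift_kpush M E K G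
    rw [h2]
    simp only [frame, tr] at h1 ⊢
    refine h1.trans_left (Reds.dot .refl (tr_reds_cont M E ?_ .refl))
    rw [Env.kpush_up]
    exact .single (.lam (Red.drop _ _))

theorem isVal_of_compat_rule {s : Srt} {e e' : Exp s} (h : Compat Rule s e e')
    (he : isVal e = true) : isVal e' = true := by
  cases h with
  | root h =>
    cases h with
    | etaLam V hV => exact isVal_iff.2 hV
    | _ => cases he
  | lam _ => rfl
  | _ => cases he

/-- The claim about `val` is needed because values in applications are translated without `tr`.
Where the reduced subterm lies in a frame that may be erased, strictness comes from its copy in the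
guard. -/
theorem redp_compat_rule {s : Srt} {e e' : Exp s} (h : Compat Rule s e e') :
    (∀ (E : Env) (K G : Tm), E.Good → GoodCont E.d K G → Redp (tr e E K G) (tr e' E K G)) ∧
    (isVal e = true → ∀ E : Env, E.Good → Redp (val e E) (val e' E)) := by
  induction h with
  | root h =>
    refine ⟨fun E K G _ hK => redp_rule h hK, fun he E _ => ?_⟩
    cases h with
    | etaLam V hV =>
      simp only [val]
      exact redp_lamVal_app_shift_var (isVal_iff.2 hV) E
    | _ => cases he
  | @lam M M' _ ih =>
    have key : ∀ E : Env, E.Good → Redp (lamVal (tr M) E) (lamVal (tr M') E) := fun E hE =>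
      Redp.lam (Redp.lam (Redp.dotL (ih.1 _ _ _ hE.up.up .refl)
        (Reds.app (Reds.lam (ih.1 _ _ _ (hE.up.up.up.push _) .refl).to_reflTransGen) .refl)))
    refine ⟨fun E K G hE _ => ?_, fun _ E hE => ?_⟩
    · simp only [tr]
      exact Redp.dotR .refl (Redp.appR .refl (key E hE))
    · simp only [val]
      exact key E hE
  | @appL M M' N hc ih =>
    refine ⟨fun E K G hE hK => ?_, fun he => by cases he⟩
    by_cases h : isVal M = true
    · rw [tr_app_of_isVal h, tr_app_of_isVal (isVal_of_compat_rule hc h)]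
      by_cases h' : isVal N = true
      · rw [appTr_of_isVal h', appTr_of_isVal h']
        exact Redp.dotR .refl (Redp.appL (Redp.appL (ih.2 h E hE) .refl) .refl)
      · rw [appTr_of_not_isVal h', appTr_of_not_isVal h']
        have hv := ih.2 h E hE
        exact Redp.dotR .refl (tr_redp_cont N rfl E
          (Reds.lam (Reds.dot .refl (Reds.app (Reds.app (Reds.shift hv.to_reflTransGen) .refl) .refl)))
          (Redp.dotR .refl (Redp.appL (Redp.appL hv .refl) .refl)))
    · have hs := Redp.dotR (.refl (a := G)) (ih.1 E _ _ hE (goodCont_appFrame N E K G))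
      rw [tr_app_of_not_isVal h]
      refine hs.trans_left ?_
      by_cases h' : isVal M' = true
      -- A non-value has become a value, so the translation changes shape: two drops and one β-step
      -- remove the frame.
      · rw [tr_app_of_isVal h', tr_of_isVal h']
        have := Red.beta (appTr N (.var 0) E.up K.shift G.shift) (val M' E)
        rw [appTr_subst_single] at this
        exact .head (Red.drop _ _) (.head (Red.drop _ _) (.single this))
      · rw [tr_app_of_not_isVal h']
  | @appR M N N' hc ih =>
    refine ⟨fun E K G hE hK => ?_, fun he => by cases he⟩
    have key : ∀ (v : Tm) (E : Env) (K G : Tm), E.Good →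
        Redp (appTr N v E K G) (appTr N' v E K G) := by
      intro v E K G hE
      by_cases h : isVal N = true
      · rw [appTr_of_isVal h, appTr_of_isVal (isVal_of_compat_rule hc h)]
        exact Redp.dotR .refl (Redp.appR .refl (ih.2 h E hE))
      · have hs := Redp.dotR (.refl (a := G)) (ih.1 E _ _ hE (goodCont_argFrame E.d v K G))
        rw [appTr_of_not_isVal h]
        refine hs.trans_left ?_
        by_cases h' : isVal N' = true
        · rw [appTr_of_isVal h', tr_of_isVal h']
          have := Red.beta (.dot G.shift (.app (.app v.shift K.shift) (.var 0))) (val N' E)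
          simp only [Tm.subst, DotLam.subst_single_shift] at this
          exact .head (Red.drop _ _) (.head (Red.drop _ _) (.single this))
        · rw [appTr_of_not_isVal h']
    by_cases h : isVal M = true
    · rw [tr_app_of_isVal h, tr_app_of_isVal h]
      exact key _ E K G hE
    · rw [tr_app_of_not_isVal h, tr_app_of_not_isVal h]
      exact Redp.dotR .refl (tr_redp_cont M rfl E
        (Reds.lam (key _ _ _ _ hE.up).to_reflTransGen) (key _ E K G hE))
  | @lettL s L L' M hc ih =>
    refine ⟨fun E K G hE hK => ?_, fun he => by cases he⟩
    rw [tr_lett, tr_lett]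
    exact tr_redp_cont M rfl E (Reds.lam (ih.1 _ _ _ (hE.up.push _) hK.shift).to_reflTransGen)
      (ih.1 _ _ _ hE hK)
  | @lettR s L M M' hc ih =>
    refine ⟨fun E K G hE hK => ?_, fun he => by cases he⟩
    rw [tr_lett, tr_lett]
    exact ih.1 E _ _ hE (goodCont_frame L E K G)
  | mu _ ih =>
    refine ⟨fun E K G hE hK => ?_, fun he => by cases he⟩
    simp only [tr]
    exact Redp.dotR .refl (ih.1 _ _ _ (hE.kpush hK) hK)
  | @jmp k M M' _ ih =>
    refine ⟨fun E K G hE hK => ?_, fun he => by cases he⟩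
    simp only [tr]
    exact ih.1 E _ _ hE (hE k)

theorem redp_of_step {s : Srt} {e e' : Exp s} (h : Step s e e') {E : Env} {K G : Tm}
    (hE : E.Good) (hK : GoodCont E.d K G) : Redp (tr e E K G) (tr e' E K G) := by
  obtain ⟨M, N, h1, h2, h3⟩ := h
  rw [h1.tr_eq.1, ← h3.tr_eq.1]
  exact (redp_compat_rule h2).1 E K G hE hK

end CCV

-- CCV: typed expressions have strongly normalizing translations

namespace CCV

open DotLam (Tm Red Reds Redp SN)
open Relation

/-! ### Soundness of the typing rules -/

mutual

/-- The translation of raw types: `S → T` becomes `¬T → S → ⊥⊥`. -/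
def RawTy.cps {A : Type u} : RawTy A → DotLam.STy A
  | .atom a => .atom a
  | .arr S T => .arr T.neg (.arr S.cps .bot)

/-- The translation of subsidiary types. -/
def SubTy.cps {A : Type u} : SubTy A → DotLam.ITy A
  | .inter n R => .inter n (fun i => (R i).cps)

/-- The type of the continuations of a type. -/
def UTy.neg {A : Type u} : UTy A → DotLam.ITy A
  | .union n S => .inter n (fun i => .arr (S i).cps .bot)

end

/-- Proved together with covariance of the translations of raw and subsidiary types, as the three
subtyping relations are mutually inductive. -/
theorem ULe.neg {A : Type u} {T T' : UTy A} (h : ULe T T') : DotLam.ILe T'.neg T.neg := by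
  refine ULe.rec (motive_1 := fun R R' _ => DotLam.SLe R.cps R'.cps)
    (motive_2 := fun S S' _ => DotLam.ILe S.cps S'.cps)
    (motive_3 := fun T T' _ => DotLam.ILe T'.neg T.neg) ?_ ?_ ?_ ?_ h
  · intro a
    simp only [RawTy.cps]
    exact .atom a
  · intro _ _ _ _ _ _ h1 h2
    simp only [RawTy.cps]
    exact .arr h2 (.arr h1 .bot)
  · intro _ _ _ _ f _ h
    simp only [SubTy.cps]
    exact .inter f h
  · intro _ _ _ _ f _ h
    simp only [UTy.neg]
    exact .inter f fun i => .arr (h i) .bot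

theorem UTy.sem_neg_union {A : Type u} {n : ℕ} {S : Fin (n + 1) → SubTy A} {K : Tm} :
    (UTy.union n S).neg.sem K ↔ ∀ i V, (S i).cps.sem V → SN (.app K V) := by
  simp only [UTy.neg, DotLam.ITy.sem, DotLam.STy.sem]

theorem RawTy.sem_arr {A : Type u} {S : SubTy A} {T : UTy A} {v : Tm} :
    (RawTy.arr S T).cps.sem v ↔
      ∀ K, T.neg.sem K → ∀ V, S.cps.sem V → SN (.app (.app v K) V) := by
  simp only [RawTy.cps, DotLam.STy.sem]

theorem SubTy.sem_inter {A : Type u} {n : ℕ} {R : Fin (n + 1) → RawTy A} {v : Tm} :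
    (SubTy.inter n R).cps.sem v ↔ ∀ i, (R i).cps.sem v := by
  simp only [SubTy.cps, DotLam.ITy.sem]

theorem SubTy.sem_var {A : Type u} (S : SubTy A) (n : ℕ) : S.cps.sem (.var n) :=
  (DotLam.ITy.sem_isCandidate _).var n

theorem SubTy.sn_of_sem {A : Type u} {S : SubTy A} {V : Tm} (h : S.cps.sem V) : SN V :=
  (DotLam.ITy.sem_isCandidate _).sn _ h

theorem UTy.sn_of_sem_neg {A : Type u} {T : UTy A} {K : Tm} (h : T.neg.sem K) : SN K :=
  (DotLam.ITy.sem_isCandidate _).sn _ h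

theorem UTy.sn_app_var {A : Type u} {T : UTy A} {K : Tm} (h : T.neg.sem K) (n : ℕ) :
    SN (.app K (.var n)) := by
  cases T with
  | union m S => exact UTy.sem_neg_union.1 h 0 _ ((S 0).sem_var n)

/-- The environment respects the types of the variables. -/
structure Env.Models {A : Type u} (E : Env) (Γ : List (SubTy A)) (Δ : List (UTy A)) : Prop where
  -- Variables lie in every candidate, so the dummy can act as a value of any type.
  d : ∃ n, E.d = .var n
  v : ∀ (x : ℕ) (S : SubTy A), Γ[x]? = some S → S.cps.sem (E.v x)
  k : ∀ (k : ℕ) (T : UTy A), Δ[k]? = some T → T.neg.sem (E.k k).1 ∧ SN (E.k k).2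

theorem Env.Models.push {A : Type u} {E : Env} {Γ : List (SubTy A)} {Δ : List (UTy A)}
    (h : E.Models Γ Δ) {S : SubTy A} {V : Tm} (hV : S.cps.sem V) :
    (E.push V).Models (S :: Γ) Δ := by
  refine ⟨h.d, fun x S' hx => ?_, h.k⟩
  cases x with
  | zero => cases hx; exact hV
  | succ x => exact h.v x S' hx

theorem Env.Models.push_d {A : Type u} {E : Env} {Γ : List (SubTy A)} {Δ : List (UTy A)}
    (h : E.Models Γ Δ) (S : SubTy A) : (E.push E.d).Models (S :: Γ) Δ := by
  obtain ⟨n, hn⟩ := h.d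
  exact h.push (hn ▸ S.sem_var n)

theorem Env.Models.kpush {A : Type u} {E : Env} {Γ : List (SubTy A)} {Δ : List (UTy A)}
    (h : E.Models Γ Δ) {T : UTy A} {K G : Tm} (hK : T.neg.sem K) (hG : SN G) :
    (E.kpush K G).Models Γ (T :: Δ) := by
  refine ⟨h.d, h.v, fun k T' hk => ?_⟩
  cases k with
  | zero => cases hk; exact ⟨hK, hG⟩
  | succ k => exact h.k k T' hk

/-- The continuations of what is assigned by a judgement. -/
def Res.Cont {A : Type u} : {s : Srt} → Res A s → Tm → Tm → Prop
  | _, .ty T, K, G => T.neg.sem K ∧ SN G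
  | _, .bot, _, _ => True

theorem sn_app_lam {P V : Tm} (hV : SN V) (h : SN (P.subst (DotLam.Tm.single V))) :
    SN (.app (.lam P) V) :=
  DotLam.isCandidate_sn.app_lam hV h

theorem sn_app_frame {s : Srt} {e : Exp s} {E : Env} {K G V : Tm} (hV : SN V)
    (h : SN (tr e (E.push V) K G)) : SN (.app (frame (tr e) E K G) V) :=
  sn_app_lam hV (by rw [tr_push_subst_single]; exact h)

theorem sem_lamVal {A : Type u} {M : Term} {E : Env} {S : SubTy A} {T : UTy A}
    (hd : ∃ n, E.d = .var n)
    (h : ∀ V, S.cps.sem V → ∀ K G, T.neg.sem K → SN G → SN (tr M (E.push V) K G)) :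
    (RawTy.arr S T).cps.sem (lamVal (tr M) E) := by
  obtain ⟨n, hn⟩ := hd
  simp only [RawTy.cps, DotLam.STy.sem]
  intro K hK
  have hc := DotLam.STy.sem_isCandidate (DotLam.STy.arr S.cps (DotLam.STy.bot (A := A)))
  simp only [DotLam.STy.sem] at hc
  refine hc.app_lam (UTy.sn_of_sem_neg hK) fun V hV => ?_
  refine sn_app_lam (SubTy.sn_of_sem hV) ?_
  rw [lamVal_body_subst]
  have hG : SN (.app K E.d) := hn ▸ UTy.sn_app_var hK n
  exact SN.dot (h _ (hn ▸ S.sem_var n) K _ hK hG)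
    (sn_app_frame (SubTy.sn_of_sem hV) (h V hV K _ hK hG))

theorem sn_tr_of_typing {A : Type u} {Γ : List (SubTy A)} {Δ : List (UTy A)} {s : Srt}
    {e : Exp s} {ρ : Res A s} (h : Typing Γ Δ s e ρ) {E : Env} (hE : E.Models Γ Δ) {K G : Tm}
    (hK : ρ.Cont K G) : SN (tr e E K G) := by
  induction h generalizing E K G with
  | var hx =>
    simp only [tr]
    exact hK.2.dot (UTy.sem_neg_union.1 hK.1 0 _ (hE.v _ _ hx))
  | @lam Γ Δ M n S T _ ih =>
    simp only [tr]
    refine hK.2.dot (UTy.sem_neg_union.1 hK.1 0 _ (SubTy.sem_inter.2 fun i => ?_))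
    exact sem_lamVal hE.d fun V hV K G hK hG => ih i (hE.push hV) ⟨hK, hG⟩
  | @app Γ Δ M N n m S T _ _ ih1 ih2 =>
    obtain ⟨p, hp⟩ := hE.d
    obtain ⟨hK, hG⟩ := hK
    -- Elimination of the outer union: once `v` is known to lie in the member `i`, the typing of `N`
    -- for that same `i` is used, and the frame of `N` accepts each `S i j`.
    have key : ∀ i v, (∀ j, (RawTy.arr (S i j) T).cps.sem v) → SN (appTr N v E K G) := by
      intro i v hv
      have hvK : ∀ j V, (S i j).cps.sem V → SN (.app (.app v K) V) := fun j =>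
        RawTy.sem_arr.1 (hv j) K hK
      have hs : SN (tr N E (.lam (.dot G.shift (.app (.app v.shift K.shift) (.var 0))))
          (.dot G (.app (.app v K) E.d))) := by
        refine ih2 i hE ⟨UTy.sem_neg_union.2 fun j V hV => sn_app_lam (SubTy.sn_of_sem hV) ?_,
          hG.dot (hvK 0 _ (hp ▸ (S i 0).sem_var p))⟩
        simp only [Tm.subst, DotLam.subst_single_shift]
        exact hG.dot (hvK j V hV)
      by_cases h : isVal N = true
      -- For a value `N` the frameless translation is a β-reduct of the right component of the
      -- framed one, so it inherits strong normalization.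
      · rw [appTr_of_isVal h]
        rw [tr_of_isVal h] at hs
        have := Red.beta (.dot G.shift (.app (.app v.shift K.shift) (.var 0))) (val N E)
        simp only [Tm.subst, DotLam.subst_single_shift] at this
        exact hs.of_dotR.red this
      · rw [appTr_of_not_isVal h]
        exact hG.dot hs
    have hs : SN (tr M E (.lam (appTr N (.var 0) E.up K.shift G.shift))
        (appTr N E.d E K G)) := by
      refine ih1 hE ⟨UTy.sem_neg_union.2 fun i V hV => sn_app_lam (SubTy.sn_of_sem hV) ?_,
        key 0 _ fun j => hp ▸ (DotLam.STy.sem_isCandidate _).var p⟩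
      rw [appTr_subst_single]
      exact key i V (SubTy.sem_inter.1 hV)
    by_cases h : isVal M = true
    · rw [tr_app_of_isVal h]
      rw [tr_of_isVal h] at hs
      have := Red.beta (appTr N (.var 0) E.up K.shift G.shift) (val M E)
      rw [appTr_subst_single] at this
      exact hs.of_dotR.red this
    · rw [tr_app_of_not_isVal h]
      exact hG.dot hs
  | lett _ _ ih1 ih2 =>
    rw [tr_lett]
    exact ih2 hE ⟨UTy.sem_neg_union.2 fun i V hV =>
      sn_app_frame (SubTy.sn_of_sem hV) (ih1 i (hE.push hV) hK), ih1 0 (hE.push_d _) hK⟩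
  | mu _ ih =>
    simp only [tr]
    exact hK.2.dot (ih (hE.kpush hK.1 hK.2) trivial)
  | jmp hk _ ih =>
    simp only [tr]
    exact ih hE (hE.k _ _ hk)
  | sub _ hle ih => exact ih hE ⟨hle.neg.sem _ hK.1, hK.2⟩
  | same hs _ ih =>
    rw [← hs.tr_eq.1]
    exact ih hE hK

theorem stronglyNormalizable_of_typeable {A : Type u} {M : Term} (h : Typeable A M) :
    StronglyNormalizable M := by
  obtain ⟨Γ, Δ, T, h⟩ := h
  -- The guard is literally the continuation applied to the dummy, so goodness holds by reflexivity.
  let E : Env := ⟨.var 0, .var, fun _ => (.var 0, .app (.var 0) (.var 0))⟩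
  have hneg : ∀ T : UTy A, T.neg.sem (.var 0) := fun T => (DotLam.ITy.sem_isCandidate _).var 0
  have hs : SN (tr M E (.var 0) (.app (.var 0) (.var 0))) :=
    sn_tr_of_typing h ⟨⟨0, rfl⟩, fun x S _ => S.sem_var x,
      fun _ T _ => ⟨hneg T, UTy.sn_app_var (hneg T) 0⟩⟩ ⟨hneg T, UTy.sn_app_var (hneg T) 0⟩
  exact SN.of_redp (f := fun M => tr M E (.var 0) (.app (.var 0) (.var 0)))
    (fun _ _ r => redp_of_step r (fun _ => .refl) .refl) hs

end CCV

theorem mainTheorem6 (A : Type u) :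
    (∀ M : CCV.Term, CCV.Typeable A M → CCV.StronglyNormalizable M) ∧
    (∀ (Γ : List (DotLam.ITy A)) (M : DotLam.Tm) (σ : DotLam.STy A),
      DotLam.Typing Γ M σ → DotLam.StronglyNormalizable M) :=
  ⟨fun _ h => CCV.stronglyNormalizable_of_typeable h,
    fun _ _ _ h => DotLam.stronglyNormalizable_of_typing h⟩
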